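/- **Setting.** Let $(V,g)$ be a finite-dimensional real vector space with a non-degenerate symmetric bilinear form of arbitrary signature, and let $M\subset V$ be one of the standard models of constant sectional curvature manifolds: either the (pseudo-)sphere $M=\{x\in V: g(x,x)=1\}$, assumed non-empty, or (flat case) the hyperplane $M=\{x\in V: g(x,u)=1\}$ with a non-null normal vector $u\in V$, $g(u,u)\neq 0$. $M$ carries the induced metric, also denoted $g$; $\nabla$ is its Levi-Civita connection. Latin indices are components in $V$ with respect to a basis and are raised and lowered with $g_{ab}$; Greek indices are components on $M$. Let $\bar g=g$ if $M$ is a (pseudo-)sphere, and for the hyperplane let $\bar g_{ab}=g_{ab}-u_au_b/g(u,u)$ (the degenerate pullback of the metric of the hyperplane under the orthogonal projection; $\bar g_{ab}=g_{ab}-u_au_b$ if $u$ is a unit vector). Let $K$ be a Killing tensor on $M$, i.e. a smooth symmetric tensor field $K_{\alpha\beta}$ with $\nabla_{(\alpha}K_{\beta\gamma)}=0$, regarded also as an endomorphism field via $g$. Let $S$ be the corresponding symmetrised algebraic curvature tensor and $R$ the corresponding algebraic curvature tensor on $V$: $S$ satisfies $S_{a_2a_1b_1b_2}=S_{a_1a_2b_1b_2}=S_{a_1a_2b_2b_1}$,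 $S_{b_1b_2a_1a_2}=S_{a_1a_2b_1b_2}$, $S_{a_1a_2b_1b_2}+S_{a_1b_2a_2b_1}+S_{a_1b_1b_2a_2}=0$; $R$ has the algebraic symmetries of a Riemannian curvature tensor, namely $R_{b_1a_1a_2b_2}=-R_{a_1b_1a_2b_2}=R_{a_1b_1b_2a_2}$, $R_{a_2b_2a_1b_1}=R_{a_1b_1a_2b_2}$, $R_{a_1b_1a_2b_2}+R_{a_1a_2b_2b_1}+R_{a_1b_2b_1a_2}=0$; and $$K_x(v,w)=S_{a_1a_2b_1b_2}x^{a_1}x^{a_2}v^{b_1}w^{b_2}=R_{a_1b_1a_2b_2}x^{a_1}v^{b_1}x^{a_2}w^{b_2}\qquad(x\in M,\ v,w\in T_xM).$$ Let $N(X,Y)=K^2[X,Y]-K[KX,Y]-K[X,KY]+[KX,KY]$ be the Nijenhuis torsion of $K$. For a set $A$ of index names write $\mathrm{Sym}_A=\sum_{\pi\in S_A}\pi$ and $\mathrm{Alt}_A=\sum_{\pi\in S_A}\operatorname{sign}(\pi)\,\pi$, acting on tensors by permuting index names. **Proposition (Second integrability condition).** Suppose $K$ satisfies the first integrability condition $N^\delta{}_{[\beta\gamma}g_{\alpha]\delta}=0$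 on $M$. Then the following conditions are equivalent. 0. The second integrability condition $N^\delta{}_{[\beta\gamma}K_{\alpha]\delta}=0$ on $M$. 1. (hook conditions; $\mathrm{Alt}\circ\mathrm{Sym}$ is the adjoint Young symmetriser of the hook tableau with first row $b_2,b_1,d_1,e_1,e_2$ and first column $b_2,c_2,d_2,f_2$; $\mathrm{Sym}$ is applied first) - (1a) $\mathrm{Alt}_{b_2c_2d_2f_2}\mathrm{Sym}_{b_2b_1d_1e_1e_2}\;\bar g_{ij}\bar g_{kl}\,S^i{}_{c_2d_1d_2}\,S^j{}_{b_1}{}^k{}_{b_2}\,S^l{}_{f_2e_1e_2}=0$; - (1b) $\mathrm{Alt}_{b_2c_2d_2f_2}\mathrm{Sym}_{b_2b_1d_1e_1e_2}\;\bar g_{ij}\bar g_{kl}\,S^i{}_{c_2b_1b_2}\,S^j{}_{d_1}{}^k{}_{d_2}\,S^l{}_{f_2e_1e_2}=0$. 2. (antisymmetrisation in three and symmetrisation in five indices) - (2a) $\mathrm{Alt}_{c_2d_2f_2}\mathrm{Sym}_{b_2b_1d_1e_1e_2}\;\bar g_{ij}\bar g_{kl}\,S^i{}_{c_2d_1d_2}\,S^j{}_{b_1}{}^k{}_{b_2}\,S^l{}_{f_2e_1e_2}=0$;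 - (2b) $\mathrm{Alt}_{c_2d_2f_2}\mathrm{Sym}_{b_2b_1d_1e_1e_2}\;\bar g_{ij}\bar g_{kl}\,S^i{}_{c_2b_1b_2}\,S^j{}_{d_1}{}^k{}_{d_2}\,S^l{}_{f_2e_1e_2}=0$. 3. (antisymmetrisation in four and symmetrisation in four indices) - (3a) $\mathrm{Alt}_{b_2c_2d_2f_2}\mathrm{Sym}_{b_1d_1e_1e_2}\;\bar g_{ij}\bar g_{kl}\,S^i{}_{c_2d_1d_2}\,S^j{}_{b_1}{}^k{}_{b_2}\,S^l{}_{f_2e_1e_2}=0$; - (3b) $\mathrm{Alt}_{b_2c_2d_2f_2}\mathrm{Sym}_{b_1d_1e_1e_2}\;\bar g_{ij}\bar g_{kl}\,S^i{}_{c_2d_1d_2}\,S^j{}_{b_2}{}^k{}_{b_1}\,S^l{}_{f_2e_1e_2}=0$; - (3c) $\mathrm{Alt}_{b_2c_2d_2f_2}\mathrm{Sym}_{b_1d_1e_1e_2}\;\bar g_{ij}\bar g_{kl}\,S^i{}_{c_2d_1d_2}\,S^j{}_{e_1}{}^k{}_{e_2}\,S^l{}_{f_2b_1b_2}=0$. 4.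 $\mathrm{Alt}_{b_2c_2d_2f_2}\mathrm{Sym}_{b_1d_1e_1e_2}\;\bar g_{ij}\bar g_{kl}\,R^i{}_{d_1c_2d_2}\,R^j{}_{e_1}{}^k{}_{e_2}\,R^l{}_{b_1f_2b_2}=0$. -/

import Mathlib

open scoped ContDiff

noncomputable section

namespace KillingCSC

/-! ### Standard models of constant sectional curvature manifolds -/

section Geometry

variable {V : Type*} [NormedAddCommGroup V] [NormedSpace ℝ V]

/-- The two kinds of standard models inside `(V, g)`: the (pseudo-)sphere `g(x,x) = 1`, and the
hyperplane `g(x,u) = 1` with normal vector `u`. -/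
inductive StandardModel (V : Type*) where
  | sphere : StandardModel V
  | hyperplane (u : V) : StandardModel V

namespace StandardModel

/-- The underlying subset `M` of `V`. -/
def carrier (g : LinearMap.BilinForm ℝ V) : StandardModel V → Set V
  | sphere => {x | g x x = 1}
  | hyperplane u => {x | g x u = 1}

/-- The normal vector of `M ⊆ V` at `x`. -/
def normal : StandardModel V → V → V
  | sphere, x => x
  | hyperplane u, _ => u

/-- `M` is a nonempty pseudo-Riemannian hypersurface of `(V, g)`: the pseudo-sphere is required to
be nonempty, the normal `u` of the hyperplane is required to be non-null. -/
def IsAdmissible (g : LinearMap.BilinForm ℝ V) : StandardModel V → Prop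
  | sphere => ∃ x, g x x = 1
  | hyperplane u => g u u ≠ 0

/-- `v` is a tangent vector of `M` at `x`. -/
def IsTangent (g : LinearMap.BilinForm ℝ V) (M : StandardModel V) (x v : V) : Prop :=
  g v (M.normal x) = 0

/-- The `g`-orthogonal projection `V → T_x M`. -/
def tangentProj (g : LinearMap.BilinForm ℝ V) (M : StandardModel V) (x v : V) : V :=
  v - (g v (M.normal x) / g (M.normal x) (M.normal x)) • M.normal x

/-- The form `ḡ` on `V`: it is `g` if `M` is not flat, and for a hyperplane it is the
(degenerate) pullback of the metric along the orthogonal projection to the hyperplane, which is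
`g_ab - u_a u_b` if the normal vector `u` has `g(u,u) = 1`. -/
def gbar (g : LinearMap.BilinForm ℝ V) : StandardModel V → V → V → ℝ
  | sphere, v, w => g v w
  | hyperplane u, v, w => g v w - g v u * g w u / g u u

/-- `X` is (the restriction to `M` of) a smooth vector field on `M`; only its values on `M`
matter. -/
structure IsVectorField (g : LinearMap.BilinForm ℝ V) (M : StandardModel V) (X : V → V) :
    Prop where
  smooth : ContDiffOn ℝ ∞ X (M.carrier g)
  tangent : ∀ x ∈ M.carrier g, M.IsTangent g x (X x)

/-- The Levi-Civita connection `∇_X Y` of the induced metric on `M` at `x` (Gauss formula): the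
tangential part of the flat derivative of `Y` along `M` in the direction `X x`. -/
def nabla (g : LinearMap.BilinForm ℝ V) (M : StandardModel V) (X Y : V → V) (x : V) : V :=
  M.tangentProj g x (fderivWithin ℝ Y (M.carrier g) x (X x))

/-- The covariant derivative `(∇_X K)(Y, Z)` at `x`, where the endomorphism field `K` is regarded
as the `(0,2)`-tensor field `K(v, w) = g(K v, w)`. -/
def nablaTensor (g : LinearMap.BilinForm ℝ V) (M : StandardModel V) (K : V → V →ₗ[ℝ] V)
    (X Y Z : V → V) (x : V) : ℝ :=
  fderivWithin ℝ (fun y => g (K y (Y y)) (Z y)) (M.carrier g) x (X x)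
    - g (K x (M.nabla g X Y x)) (Z x) - g (K x (Y x)) (M.nabla g X Z x)

/-- `K` is a Killing tensor on `M`, written as a `(1,1)`-tensor field `x ↦ K_x`. Only the values of
`K_x` on `T_x M` for `x ∈ M` matter. -/
structure IsKillingTensor (g : LinearMap.BilinForm ℝ V) (M : StandardModel V)
    (K : V → V →ₗ[ℝ] V) : Prop where
  /-- `K` maps smooth vector fields on `M` to smooth vector fields on `M`. -/
  smooth : ∀ X, M.IsVectorField g X → M.IsVectorField g (fun x => K x (X x))
  /-- The covariant tensor `K_{αβ}` is symmetric. -/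
  symm : ∀ x ∈ M.carrier g, ∀ v w, M.IsTangent g x v → M.IsTangent g x w →
    g (K x v) w = g (K x w) v
  /-- The Killing equation `∇_{(α} K_{βγ)} = 0`. -/
  killing : ∀ X Y Z, M.IsVectorField g X → M.IsVectorField g Y → M.IsVectorField g Z →
    ∀ x ∈ M.carrier g,
      M.nablaTensor g K X Y Z x + M.nablaTensor g K Y Z X x + M.nablaTensor g K Z X Y x = 0

/-- The Nijenhuis torsion
`N(X,Y) = K²[X,Y] - K[KX,Y] - K[X,KY] + [KX,KY]` of `K` on `M`. -/
def nijenhuis (g : LinearMap.BilinForm ℝ V) (M : StandardModel V) (K : V → V →ₗ[ℝ] V)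
    (X Y : V → V) (x : V) : V :=
  K x (K x (VectorField.lieBracketWithin ℝ X Y (M.carrier g) x))
    - K x (VectorField.lieBracketWithin ℝ (fun y => K y (X y)) Y (M.carrier g) x)
    - K x (VectorField.lieBracketWithin ℝ X (fun y => K y (Y y)) (M.carrier g) x)
    + VectorField.lieBracketWithin ℝ (fun y => K y (X y)) (fun y => K y (Y y)) (M.carrier g) x

/-- First integrability condition `N^δ_{[βγ} g_{α]δ} = 0`. -/
def FirstIntegrability (g : LinearMap.BilinForm ℝ V) (M : StandardModel V)
    (K : V → V →ₗ[ℝ] V) : Prop :=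
  ∀ X : Fin 3 → V → V, (∀ i, M.IsVectorField g (X i)) → ∀ x ∈ M.carrier g,
    ∑ σ : Equiv.Perm (Fin 3), ((Equiv.Perm.sign σ : ℤ) : ℝ) *
      g (M.nijenhuis g K (X (σ 0)) (X (σ 1)) x) (X (σ 2) x) = 0

/-- Second integrability condition `N^δ_{[βγ} K_{α]δ} = 0`. -/
def SecondIntegrability (g : LinearMap.BilinForm ℝ V) (M : StandardModel V)
    (K : V → V →ₗ[ℝ] V) : Prop :=
  ∀ X : Fin 3 → V → V, (∀ i, M.IsVectorField g (X i)) → ∀ x ∈ M.carrier g,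
    ∑ σ : Equiv.Perm (Fin 3), ((Equiv.Perm.sign σ : ℤ) : ℝ) *
      g (K x (X (σ 2) x)) (M.nijenhuis g K (X (σ 0)) (X (σ 1)) x) = 0

end StandardModel

end Geometry

/-! ### Algebraic curvature tensors -/

section Algebra

variable {V : Type*} [AddCommGroup V] [Module ℝ V]

/-- Covariant tensors of valence four on `V`. -/
abbrev Tensor4 (V : Type*) [AddCommGroup V] [Module ℝ V] : Type _ :=
  V →ₗ[ℝ] V →ₗ[ℝ] V →ₗ[ℝ] V →ₗ[ℝ] ℝ

/-- Algebraic curvature tensors `R_{a₁ b₁ a₂ b₂}`. -/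
structure IsCurvatureTensor (R : Tensor4 V) : Prop where
  anti_left : ∀ a₁ b₁ a₂ b₂, R b₁ a₁ a₂ b₂ = -R a₁ b₁ a₂ b₂
  anti_right : ∀ a₁ b₁ a₂ b₂, R a₁ b₁ b₂ a₂ = -R a₁ b₁ a₂ b₂
  pair : ∀ a₁ b₁ a₂ b₂, R a₂ b₂ a₁ b₁ = R a₁ b₁ a₂ b₂
  bianchi : ∀ a₁ b₁ a₂ b₂, R a₁ b₁ a₂ b₂ + R a₁ a₂ b₂ b₁ + R a₁ b₂ b₁ a₂ = 0

/-- Symmetrised algebraic curvature tensors `S_{a₁ a₂ b₁ b₂}`. -/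
structure IsSymCurvatureTensor (S : Tensor4 V) : Prop where
  symm_left : ∀ a₁ a₂ b₁ b₂, S a₂ a₁ b₁ b₂ = S a₁ a₂ b₁ b₂
  symm_right : ∀ a₁ a₂ b₁ b₂, S a₁ a₂ b₂ b₁ = S a₁ a₂ b₁ b₂
  pair : ∀ a₁ a₂ b₁ b₂, S b₁ b₂ a₁ a₂ = S a₁ a₂ b₁ b₂
  bianchi : ∀ a₁ a₂ b₁ b₂, S a₁ a₂ b₁ b₂ + S a₁ b₂ a₂ b₁ + S a₁ b₁ b₂ a₂ = 0

end Algebra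

section Correspondence

variable {V : Type*} [NormedAddCommGroup V] [NormedSpace ℝ V]

/-- `R` is the algebraic curvature tensor of `K`:
`K_x(v,w) = R_{a₁ b₁ a₂ b₂} x^{a₁} v^{b₁} x^{a₂} w^{b₂}` for `x ∈ M` and `v, w ∈ T_x M`. -/
def RepresentsR (g : LinearMap.BilinForm ℝ V) (M : StandardModel V) (K : V → V →ₗ[ℝ] V)
    (R : Tensor4 V) : Prop :=
  ∀ x ∈ M.carrier g, ∀ v w, M.IsTangent g x v → M.IsTangent g x w →
    g (K x v) w = R x v x w

/-- `S` is the symmetrised algebraic curvature tensor of `K`: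
`K_x(v,w) = S_{a₁ a₂ b₁ b₂} x^{a₁} x^{a₂} v^{b₁} w^{b₂}` for `x ∈ M` and `v, w ∈ T_x M`. -/
def RepresentsS (g : LinearMap.BilinForm ℝ V) (M : StandardModel V) (K : V → V →ₗ[ℝ] V)
    (S : Tensor4 V) : Prop :=
  ∀ x ∈ M.carrier g, ∀ v w, M.IsTangent g x v → M.IsTangent g x w →
    g (K x v) w = S x x v w

end Correspondence

/-! ### Index contractions -/

section Indices

variable {V : Type*} [NormedAddCommGroup V] [NormedSpace ℝ V]
variable {ι : Type*} [Fintype ι] [DecidableEq ι]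

/-- The components `g^{ab}` of the inverse metric in the basis `e`. -/
def metricInv (g : LinearMap.BilinForm ℝ V) (e : Module.Basis ι ℝ V) : Matrix ι ι ℝ :=
  (Matrix.of fun a b => g (e a) (e b))⁻¹

/-- The components `T^i_{a b c}`. -/
def raiseFirst (g : LinearMap.BilinForm ℝ V) (e : Module.Basis ι ℝ V) (T : Tensor4 V)
    (i a b c : ι) : ℝ :=
  ∑ p, metricInv g e i p * T (e p) (e a) (e b) (e c)

/-- The components `T^j_a^k_b` (first and third index raised). -/
def raiseFirstThird (g : LinearMap.BilinForm ℝ V) (e : Module.Basis ι ℝ V) (T : Tensor4 V)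
    (j a k b : ι) : ℝ :=
  ∑ p, ∑ q, metricInv g e j p * metricInv g e k q * T (e p) (e a) (e q) (e b)

/-- The components `ḡ_{ij} ḡ_{kl} T^i_{p q r} T^j_s^k_t T^l_{u v w}`. -/
def cubic (g : LinearMap.BilinForm ℝ V) (M : StandardModel V) (e : Module.Basis ι ℝ V)
    (T : Tensor4 V) (p q r s t u v w : ι) : ℝ :=
  ∑ i, ∑ j, ∑ k, ∑ l, M.gbar g (e i) (e j) * M.gbar g (e k) (e l) *
    raiseFirst g e T i p q r * raiseFirstThird g e T j s k t * raiseFirst g e T l u v w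

end Indices

/-! ### Young symmetrisers -/

section Young

/-- The eight index names. -/
inductive Label where
  | b1 | b2 | c2 | d1 | d2 | e1 | e2 | f2
  deriving DecidableEq

variable {ι : Type*}

/-- Components of a tensor of valence eight as a function of the values of its named indices. -/
abbrev Tensor8 (ι : Type*) : Type _ := (Label → ι) → ℝ

/-- The row symmetriser `∑_{π ∈ S_A} π`, where permutations act by permuting index names. -/
def rowSym (A : Finset Label) (T : Tensor8 ι) : Tensor8 ι := fun m =>
  ∑ π : Equiv.Perm {l // l ∈ A}, T (m ∘ Equiv.Perm.ofSubtype π)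

/-- The column antisymmetriser `∑_{π ∈ S_A} sign(π) π`. -/
def colAlt (A : Finset Label) (T : Tensor8 ι) : Tensor8 ι := fun m =>
  ∑ π : Equiv.Perm {l // l ∈ A},
    ((Equiv.Perm.sign π : ℤ) : ℝ) * T (m ∘ Equiv.Perm.ofSubtype π)

/-- The adjoint `τ⋆` of the Young symmetriser `τ = (row symmetriser) · (column antisymmetriser)` of
the hook shaped tableau with first row `b₂ b₁ d₁ e₁ e₂` and first column `b₂ c₂ d₂ f₂`. -/
def hookAdjoint (T : Tensor8 ι) : Tensor8 ι :=
  colAlt {.b2, .c2, .d2, .f2} (rowSym {.b2, .b1, .d1, .e1, .e2} T)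

/-- Antisymmetrisation in `c₂, d₂, f₂` and symmetrisation in `b₂, b₁, d₁, e₁, e₂`. -/
def alt3sym5 (T : Tensor8 ι) : Tensor8 ι :=
  colAlt {.c2, .d2, .f2} (rowSym {.b2, .b1, .d1, .e1, .e2} T)

/-- Antisymmetrisation in `b₂, c₂, d₂, f₂` and symmetrisation in `b₁, d₁, e₁, e₂`. -/
def alt4sym4 (T : Tensor8 ι) : Tensor8 ι :=
  colAlt {.b2, .c2, .d2, .f2} (rowSym {.b1, .d1, .e1, .e2} T)

end Young

end KillingCSC

end

/-! Let P be the self-adjoint projection with ḡ = g(P·,·), and let br(p,q,r) be the vector with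
components P^i_j S^j_{pqr}. Each cubic in S is then S(br(·,·,·),·,br(·,·,·),·), and K c = br(c,x,x)
for c tangent at x ∈ M. Differentiating K_x(v,w) = S(x,x,v,w) along curves in M expresses the
Nijenhuis torsion through S and br. Both integrability conditions thus say that alternations of
homogeneous polynomials in x vanish on M. Inserting x itself also gives zero, and a homogeneous
polynomial vanishing on M vanishes on V, so the conditions extend to all vectors. The first becomes
Alt S(br(c,x,x),a,x,b) = 0; granted it, the second becomes Alt U = 0 with U =
S(br(a,x,b),x,br(c,x,x),x).

By polarisation, symmetrising a set of indices amounts to inserting one vector x in all of them.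
Conditions 2, 3 and 4 then concern alternations of U, W (three arguments) and A, B, C (four
arguments). Inserting vectors br(·,·,·) into the first condition and its polarisation gives Alt W =
2 Alt U, Alt E = -2 Alt B, Alt A = -2 Alt B, Alt C = -3/2 Alt B, where E is auxiliary, and the
condition on R is 32/9 Alt C = 0. Hence conditions within each group are equivalent.

The groups are linked as follows. Putting x into one slot gives Alt₄ B = 2 Alt₃ U, so four
alternated indices imply three. Conversely, alternating over one more index turns condition 2 into
the hook condition, and evaluating the latter on a row equal to x except for one entry yields 4 Alt
B or -8 Alt B. The main lemmas are `AlgFirst.alt_cubW`, `AlgFirst.alt_cubA`, `alt4_cubB_self`,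
`tfae_cubic` and `StandardModel.nijenhuis_apply`. -/

noncomputable section

namespace KillingCSC

/-! ### Alternation in three and four arguments -/

section Alternation

variable {V : Type*}

/-- Antisymmetrisation of a function of three arguments. -/
def alt3 (F : V → V → V → ℝ) (a b c : V) : ℝ :=
  F a b c - F a c b - F b a c + F b c a + F c a b - F c b a

/-- Antisymmetrisation of a function of four arguments. -/
def alt4 (F : V → V → V → V → ℝ) (a b c d : V) : ℝ :=
  alt3 (F a) b c d - alt3 (F b) a c d + alt3 (F c) a b d - alt3 (F d) a b c

theorem alt4_of_swap_right {F : V → V → V → V → ℝ} (h : ∀ a b c d, F a b c d = F a d c b)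
    (a b c d : V) : alt4 F a b c d = 0 := by
  simp only [alt4, alt3]
  linear_combination h a b c d - h a b d c - h a c b d - h b a c d + h b a d c + h b c a d
    + h c a b d - h c a d b - h c b a d - h d a b c + h d a c b + h d b a c

theorem alt4_of_swap_outer {F : V → V → V → V → ℝ} (h : ∀ a b c d, F a b c d = F d b c a)
    (a b c d : V) : alt4 F a b c d = 0 := by
  simp only [alt4, alt3]
  linear_combination h a b c d - h a b d c - h a c b d + h a c d b + h a d b c - h a d c b
    - h b a c d + h b a d c + h b c a d - h b d a c + h c a b d - h c b a d

end Alternation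

/-! ### Cubic identities implied by the first integrability condition -/

section Contraction

variable {V : Type*} [AddCommGroup V] [Module ℝ V]

/-- The trilinear map `br` behaves like the contraction `S^i_{pqr}` of a symmetrised curvature
tensor `S` with a symmetric form. -/
structure IsContraction (S : Tensor4 V) (br : V →ₗ[ℝ] V →ₗ[ℝ] V →ₗ[ℝ] V) : Prop where
  symm : ∀ p q r, br p r q = br p q r
  cyclic : ∀ p q r, br p q r + br q r p + br r p q = 0
  adj : ∀ p q r s t u, S (br p q r) s t u = S (br s t u) p q r

/-- The algebraic form of the first integrability condition. -/
def AlgFirst (S : Tensor4 V) (br : V →ₗ[ℝ] V →ₗ[ℝ] V →ₗ[ℝ] V) : Prop :=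
  ∀ x a b c, alt3 (fun a b c => S (br c x x) a x b) a b c = 0

variable {S : Tensor4 V} {br : V →ₗ[ℝ] V →ₗ[ℝ] V →ₗ[ℝ] V}

theorem IsSymCurvatureTensor.apply_mid (hS : IsSymCurvatureTensor S) (p q x : V) :
    S p q x x = -2 * S p x q x := by
  have h := hS.bianchi p q x x
  have h2 := hS.symm_right p x x q
  linarith

theorem IsSymCurvatureTensor.apply_self (hS : IsSymCurvatureTensor S) (x y : V) :
    S x x x y = 0 := by
  have h := hS.bianchi x x x y
  have h1 := hS.symm_left x y x x
  have h2 := hS.symm_right x x x y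
  have h3 := hS.pair x x x y
  linarith

theorem IsContraction.diag (hbr : IsContraction S br) (x : V) : br x x x = 0 := by
  have h := hbr.cyclic x x x
  have : (3 : ℝ) • br x x x = 0 := by rw [← h]; module
  exact (smul_eq_zero.mp this).resolve_left (by norm_num)

theorem IsContraction.left_self (hbr : IsContraction S br) (x c : V) :
    br x x c = (-1 / 2 : ℝ) • br c x x := by
  have h := hbr.cyclic c x x
  rw [hbr.symm x x c] at h
  have : br x x c + (1 / 2 : ℝ) • br c x x = 0 := by
    have h' : (1 / 2 : ℝ) • (br c x x + br x x c + br x x c) = 0 := by rw [h, smul_zero]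
    rw [← h']; module
  rw [eq_neg_of_add_eq_zero_left this]; module

/-- With f(t) the cubic polynomial at x + ty, the combination 8(f(1) - f(-1)) - (f(2) - f(-2))
cancels the t³ coefficient and leaves 12 times the linear one. -/
theorem cubic_polarization (S : Tensor4 V) (br : V →ₗ[ℝ] V →ₗ[ℝ] V →ₗ[ℝ] V) (x y a b c : V) :
    8 * (S (br c (x + y) (x + y)) a (x + y) b - S (br c (x - y) (x - y)) a (x - y) b)
      - (S (br c (x + (2 : ℝ) • y) (x + (2 : ℝ) • y)) a (x + (2 : ℝ) • y) b
        - S (br c (x - (2 : ℝ) • y) (x - (2 : ℝ) • y)) a (x - (2 : ℝ) • y) b)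
      = 12 * (S (br c x x) a y b + S (br c x y) a x b + S (br c y x) a x b) := by
  simp only [sub_eq_add_neg, ← neg_smul, ← neg_one_smul ℝ y, map_add, map_smul,
    LinearMap.add_apply, LinearMap.smul_apply, smul_eq_mul]
  ring

theorem AlgFirst.polarized (h : AlgFirst S br) (hbr : IsContraction S br) (x y a b c : V) :
    alt3 (fun a b c => S (br c x x) a y b + 2 * S (br c x y) a x b) a b c = 0 := by
  have P := fun a b c => cubic_polarization S br x y a b c
  have h1 := h (x + y) a b c
  have h2 := h (x - y) a b c
  have h3 := h (x + (2 : ℝ) • y) a b c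
  have h4 := h (x - (2 : ℝ) • y) a b c
  have e : ∀ a b c, S (br c x y) a x b = S (br c y x) a x b := fun a b c => by rw [hbr.symm]
  have p1 := P a b c
  have p2 := P a c b
  have p3 := P b a c
  have p4 := P b c a
  have p5 := P c a b
  have p6 := P c b a
  simp only [alt3] at h1 h2 h3 h4 ⊢
  rw [← e] at p1 p2 p3 p4 p5 p6
  linear_combination (8 * (h1 - h2) - (h3 - h4) - (p1 - p2 - p3 + p4 + p5 - p6)) / 12

/-- The cubic expressions whose alternations are compared. -/
def cubU (S : Tensor4 V) (br : V →ₗ[ℝ] V →ₗ[ℝ] V →ₗ[ℝ] V) (x a b c : V) : ℝ :=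
  S (br a x b) x (br c x x) x

def cubW (S : Tensor4 V) (br : V →ₗ[ℝ] V →ₗ[ℝ] V →ₗ[ℝ] V) (x a b c : V) : ℝ :=
  S (br a x x) x (br b x x) c

def cubA (S : Tensor4 V) (br : V →ₗ[ℝ] V →ₗ[ℝ] V →ₗ[ℝ] V) (x a b c d : V) : ℝ :=
  S (br a x b) x (br c x x) d

def cubB (S : Tensor4 V) (br : V →ₗ[ℝ] V →ₗ[ℝ] V →ₗ[ℝ] V) (x a b c d : V) : ℝ :=
  S (br a x b) d (br c x x) x

def cubC (S : Tensor4 V) (br : V →ₗ[ℝ] V →ₗ[ℝ] V →ₗ[ℝ] V) (x a b c d : V) : ℝ :=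
  S (br a x b) x (br c x d) x

def cubE (S : Tensor4 V) (br : V →ₗ[ℝ] V →ₗ[ℝ] V →ₗ[ℝ] V) (x a b c d : V) : ℝ :=
  S (br a x x) b (br c x x) d

/-- The first condition is evaluated at the argument br(a,x,x). Apart from U and W it contains terms
with contractions in both of the first two slots of S; these cancel in the cyclic sum by symmetry of
that pair. -/
theorem AlgFirst.alt_cubW (h : AlgFirst S br) (hS : IsSymCurvatureTensor S)
    (hbr : IsContraction S br) (x a b c : V) :
    alt3 (cubW S br x) a b c = 2 * alt3 (cubU S br x) a b c := by
  have key : ∀ a b c, S (br c x x) (br a x x) x b - S (br b x x) (br a x x) x c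
      - cubW S br x a c b + cubW S br x a b c
      - 2 * cubU S br x b c a + 2 * cubU S br x c b a = 0 := by
    intro a b c
    have h0 := h x (br a x x) b c
    simp only [alt3] at h0
    have e : ∀ b c, S (br c x x) b x (br a x x) = cubW S br x a c b := fun b c =>
      (hS.pair x (br a x x) (br c x x) b).trans (hS.symm_left _ _ _ _)
    have e2 : ∀ b c, S (br (br a x x) x x) b x c = -2 * cubU S br x b c a := fun b c => by
      rw [hbr.adj, hS.apply_mid]; rfl
    rw [e, e, e2, e2] at h0
    linear_combination h0
  have z := fun a b c => hS.symm_left (br a x x) (br c x x) x b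
  have k1 := key a b c
  have k2 := key b c a
  have k3 := key c a b
  have z1 := z a b c
  have z2 := z b c a
  have z3 := z c a b
  generalize cubW S br x = W at *
  generalize cubU S br x = U at *
  simp only [alt3]
  linear_combination k1 + k2 + k3 - z1 - z2 - z3

/-- Polarising the first condition in the direction br(d,x,x) gives E + 2B alternated over a, b, c;
alternating over d as well gives the claim. -/
theorem AlgFirst.alt_cubE (h : AlgFirst S br) (hS : IsSymCurvatureTensor S)
    (hbr : IsContraction S br) (x a b c d : V) :
    alt4 (cubE S br x) a b c d = -2 * alt4 (cubB S br x) a b c d := by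
  have key : ∀ a b c d,
      alt3 (fun a b c => cubE S br x c a d b + 2 * cubB S br x a b d c) a b c = 0 := by
    intro a b c d
    have e : ∀ a b c, S (br c x (br d x x)) a x b = cubB S br x a b d c := fun a b c => by
      rw [hbr.adj, hS.symm_right]; rfl
    have h0 := h.polarized hbr x (br d x x) a b c
    simp only [e] at h0
    exact h0
  have k1 := key a b c d
  have k2 := key b c d a
  have k3 := key c d a b
  have k4 := key d a b c
  clear key
  generalize cubE S br x = E at *
  generalize cubB S br x = B at *
  simp only [alt3, alt4] at *
  linear_combination -(k1 - k2 + k3 - k4)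

theorem cubA_add_cubB (hS : IsSymCurvatureTensor S) (x a b c d : V) :
    S (br c x x) (br a x b) x d = -cubA S br x a b c d - cubB S br x a b c d := by
  rw [hS.symm_left]
  have h := hS.bianchi (br a x b) (br c x x) x d
  rw [hS.symm_right _ x (br c x x) d] at h
  unfold cubA cubB
  linear_combination h

/-- The first condition at the argument br(a,x,b), then alternated over all four vectors. -/
theorem AlgFirst.alt_cubC (h : AlgFirst S br) (hS : IsSymCurvatureTensor S)
    (hbr : IsContraction S br) (x a b c d : V) :
    2 * alt4 (cubC S br x) a b c d = 2 * alt4 (cubA S br x) a b c d + alt4 (cubB S br x) a b c d := by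
  have key : ∀ a b c d, 2 * cubA S br x a b c d - 2 * cubA S br x a b d c + cubB S br x a b c d
      - cubB S br x a b d c - 2 * cubC S br x a b c d + 2 * cubC S br x a b d c = 0 := by
    intro a b c d
    have h0 := h x (br a x b) c d
    simp only [alt3] at h0
    have e : ∀ c d, S (br d x x) c x (br a x b) = cubA S br x a b d c := fun c d =>
      (hS.pair x (br a x b) (br d x x) c).trans (hS.symm_left _ _ _ _)
    have e2 : ∀ c d, S (br (br a x b) x x) c x d = -2 * cubC S br x a b c d := fun c d => by
      rw [hbr.adj, hS.symm_left, hS.apply_mid]; rfl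
    rw [e, e, e2, e2, cubA_add_cubB hS, cubA_add_cubB hS] at h0
    linear_combination h0
  generalize cubA S br x = A at *
  generalize cubB S br x = B at *
  generalize cubC S br x = C at *
  simp only [alt3, alt4]
  linear_combination -(key a b c d - key a c b d + key a d b c - key b a c d + key b c a d
    - key b d a c + key c a b d - key c b a d + key c d a b - key d a b c + key d b a c
    - key d c a b)

/-- The polarised condition is used in the direction a with br(b,x,x) as one of its arguments. The
two families of terms outside A, B, E are symmetric in a pair of alternated vectors and drop out,
leaving 4 Alt A + 6 Alt B = Alt E. -/
theorem AlgFirst.alt_cubA (h : AlgFirst S br) (hS : IsSymCurvatureTensor S)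
    (hbr : IsContraction S br) (x a b c d : V) :
    alt4 (cubA S br x) a b c d = -2 * alt4 (cubB S br x) a b c d := by
  have hE := h.alt_cubE hS hbr x a b c d
  have key : ∀ a b c d, S (br d x x) (br b x x) a c - S (br c x x) (br b x x) a d
      - cubE S br x d c b a + cubE S br x c d b a
      + (S (br (br b x x) x x) c a d - S (br (br b x x) x x) d a c)
      + 2 * (-cubA S br x d a b c - cubB S br x d a b c + cubA S br x c a b d + cubB S br x c a b d
        - cubB S br x d a b c + cubB S br x c a b d
        - cubA S br x c d b a - cubB S br x c d b a
        + cubA S br x d c b a + cubB S br x d c b a) = 0 := by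
    intro a b c d
    have h0 := h.polarized hbr x a (br b x x) c d
    have e1 : ∀ c d, S (br d x a) (br b x x) x c = -cubA S br x d a b c - cubB S br x d a b c :=
      fun c d => by rw [hS.symm_left, cubA_add_cubB hS]
    have e2 : ∀ c d, S (br d x x) c a (br b x x) = cubE S br x d c b a :=
      fun c d => hS.symm_right _ _ _ _
    have e3 : ∀ c d, S (br d x a) c x (br b x x) = cubB S br x d a b c :=
      fun c d => hS.symm_right _ _ _ _
    have e4 : ∀ c d, S (br (br b x x) x a) c x d = -cubA S br x c d b a - cubB S br x c d b a :=
      fun c d => by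
        rw [hbr.adj, hS.symm_left, cubA_add_cubB hS]
    simp only [alt3, e1, e2, e3, e4] at h0
    linear_combination h0
  have hZ := alt4_of_swap_right (F := fun a b c d => S (br d x x) (br b x x) a c)
    (fun a b c d => hS.symm_left _ _ _ _) a b c d
  have hQ := alt4_of_swap_outer (F := fun a b c d => S (br (br b x x) x x) c a d)
    (fun a b c d => hS.symm_right _ _ _ _) a b c d
  generalize cubA S br x = A at *
  generalize cubB S br x = B at *
  generalize cubE S br x = E at *
  generalize hZf : (fun a b c d => S (br d x x) (br b x x) a c) = Z at *
  generalize hQf : (fun a b c d => S (br (br b x x) x x) c a d) = Q at *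
  have eZ : ∀ a b c d, S (br d x x) (br b x x) a c = Z a b c d := fun a b c d => by rw [← hZf]
  have eQ : ∀ a b c d, S (br (br b x x) x x) c a d = Q a b c d := fun a b c d => by rw [← hQf]
  simp only [eZ, eQ] at key
  clear eZ eQ hZf hQf
  simp only [alt3, alt4] at hE hZ hQ ⊢
  linear_combination (key a b c d - key a c b d + key a d b c - key b a c d + key b c a d
    - key b d a c + key c a b d - key c b a d + key c d a b - key d a b c + key d b a c
    - key d c a b - hZ - hQ + hE) / 4

/-- This is the bridge from four alternated indices to three: with Alt W = 2 Alt U the right-hand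
side is 2 Alt U. -/
theorem alt4_cubB_self (hS : IsSymCurvatureTensor S) (hbr : IsContraction S br) (x c d f : V) :
    alt4 (cubB S br x) x c d f
      = - alt3 (cubU S br x) c d f + 3 / 2 * alt3 (cubW S br x) c d f := by
  have e1 : ∀ c d f, cubB S br x c d f x = cubU S br x c d f := fun _ _ _ => rfl
  have e2 : ∀ c d f, cubB S br x c d x f = 0 := fun c d f => by
    rw [cubB, hbr.diag, map_zero]; rfl
  have e3 : ∀ c d f, cubB S br x c x d f = cubW S br x d c f := fun c d f => by
    rw [cubB, cubW, hS.pair, hS.symm_right]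
  have e4 : ∀ c d f, cubB S br x x c d f = (-1 / 2) * cubW S br x d c f := fun c d f => by
    rw [← e3, cubB, cubB, hbr.left_self, map_smul]; rfl
  simp only [alt4, alt3, e1, e2, e3, e4]
  ring

end Contraction

/-! ### Signed permutation sums as explicit alternations -/

section PermSums

variable {V : Type*}

/-- Permutations are split by the image p of 0; the transposition of 0 and p contributes the sign -1
unless p = 0. -/
theorem sum_perm_fin_succ (n : ℕ) (G : (Fin (n + 1) → V) → ℝ) (v : Fin (n + 1) → V) :
    ∑ σ : Equiv.Perm (Fin (n + 1)), ((Equiv.Perm.sign σ : ℤ) : ℝ) * G (v ∘ σ)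
      = ∑ p, (if p = 0 then 1 else -1) * ∑ τ : Equiv.Perm (Fin n),
        ((Equiv.Perm.sign τ : ℤ) : ℝ) *
          G (Fin.cons (v p) ((fun i => v (Equiv.swap 0 p (Fin.succ i))) ∘ τ)) := by
  rw [← Equiv.sum_comp (Equiv.Perm.decomposeFin (n := n)).symm, Fintype.sum_prod_type]
  refine Finset.sum_congr rfl fun p _ => ?_
  rw [Finset.mul_sum]
  refine Finset.sum_congr rfl fun τ _ => ?_
  rw [Equiv.Perm.decomposeFin.symm_sign, ← mul_assoc]
  congr 1
  · split_ifs <;> simp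
  · congr 1
    ext i
    refine Fin.cases ?_ (fun j => ?_) i <;> simp

theorem sum_perm_fin_two (G : V → V → ℝ) (v : Fin 2 → V) :
    ∑ σ : Equiv.Perm (Fin 2), ((Equiv.Perm.sign σ : ℤ) : ℝ) * G (v (σ 0)) (v (σ 1))
      = G (v 0) (v 1) - G (v 1) (v 0) := by
  have h := sum_perm_fin_succ 1 (fun v => G (v 0) (v 1)) v
  simp only [Function.comp_apply] at h
  rw [h, Fin.sum_univ_two]
  have h1 : (1 : Fin 2) = Fin.succ 0 := rfl
  simp only [h1, Fin.cons_zero, Fin.cons_succ, Finset.univ_unique, Finset.sum_singleton]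
  simp
  ring

theorem sum_perm_fin_three (G : V → V → V → ℝ) (v : Fin 3 → V) :
    ∑ σ : Equiv.Perm (Fin 3), ((Equiv.Perm.sign σ : ℤ) : ℝ) * G (v (σ 0)) (v (σ 1)) (v (σ 2))
      = alt3 G (v 0) (v 1) (v 2) := by
  have h := sum_perm_fin_succ 2 (fun v => G (v 0) (v 1) (v 2)) v
  refine h.trans ?_
  have hs : ∀ p : Fin 3, ∑ τ : Equiv.Perm (Fin 2), ((Equiv.Perm.sign τ : ℤ) : ℝ) *
      G (v p) (v (Equiv.swap 0 p (Fin.succ (τ 0)))) (v (Equiv.swap 0 p (Fin.succ (τ 1))))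
      = G (v p) (v (Equiv.swap 0 p 1)) (v (Equiv.swap 0 p 2))
        - G (v p) (v (Equiv.swap 0 p 2)) (v (Equiv.swap 0 p 1)) := fun p =>
    sum_perm_fin_two (G (v p)) (fun i => v (Equiv.swap 0 p (Fin.succ i)))
  refine (Finset.sum_congr rfl fun p _ => congrArg _ (hs p)).trans ?_
  rw [Fin.sum_univ_three]
  have e1 : Equiv.swap (0 : Fin 3) 1 2 = 2 := by decide
  have e2 : Equiv.swap (0 : Fin 3) 2 1 = 1 := by decide
  have f1 : (1 : Fin 3) ≠ 0 := by decide
  have f2 : (2 : Fin 3) ≠ 0 := by decide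
  simp only [e1, e2, f1, f2, if_true, if_false, Equiv.swap_apply_right, Equiv.swap_self,
    Equiv.refl_apply, alt3]
  ring

theorem sum_perm_fin_four (G : V → V → V → V → ℝ) (v : Fin 4 → V) :
    ∑ σ : Equiv.Perm (Fin 4),
      ((Equiv.Perm.sign σ : ℤ) : ℝ) * G (v (σ 0)) (v (σ 1)) (v (σ 2)) (v (σ 3))
      = alt4 G (v 0) (v 1) (v 2) (v 3) := by
  have h := sum_perm_fin_succ 3 (fun v => G (v 0) (v 1) (v 2) (v 3)) v
  refine h.trans ?_
  have hs : ∀ p : Fin 4, ∑ τ : Equiv.Perm (Fin 3), ((Equiv.Perm.sign τ : ℤ) : ℝ) *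
      G (v p) (v (Equiv.swap 0 p (Fin.succ (τ 0)))) (v (Equiv.swap 0 p (Fin.succ (τ 1))))
        (v (Equiv.swap 0 p (Fin.succ (τ 2))))
      = alt3 (G (v p)) (v (Equiv.swap 0 p 1)) (v (Equiv.swap 0 p 2)) (v (Equiv.swap 0 p 3)) :=
    fun p => sum_perm_fin_three (G (v p)) (fun i => v (Equiv.swap 0 p (Fin.succ i)))
  refine (Finset.sum_congr rfl fun p _ => congrArg _ (hs p)).trans ?_
  rw [Fin.sum_univ_four]
  have e1 : Equiv.swap (0 : Fin 4) 1 2 = 2 := by decide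
  have e2 : Equiv.swap (0 : Fin 4) 1 3 = 3 := by decide
  have e3 : Equiv.swap (0 : Fin 4) 2 1 = 1 := by decide
  have e4 : Equiv.swap (0 : Fin 4) 2 3 = 3 := by decide
  have e5 : Equiv.swap (0 : Fin 4) 3 1 = 1 := by decide
  have e6 : Equiv.swap (0 : Fin 4) 3 2 = 2 := by decide
  have f1 : (1 : Fin 4) ≠ 0 := by decide
  have f2 : (2 : Fin 4) ≠ 0 := by decide
  have f3 : (3 : Fin 4) ≠ 0 := by decide
  simp only [e1, e2, e3, e4, e5, e6, f1, f2, f3, if_true, if_false, Equiv.swap_apply_right,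
    Equiv.swap_self, Equiv.refl_apply, alt4, alt3]
  ring

end PermSums

/-! ### Alternation over named indices -/

section Labels

variable {V : Type*}

instance : Fintype Label where
  elems := {.b1, .b2, .c2, .d1, .d2, .e1, .e2, .f2}
  complete l := by cases l <;> decide

/-- Replace the values of the indices `b₂, c₂, d₂, f₂`. -/
def put (m : Label → V) (b c d f : V) : Label → V
  | .b2 => b | .c2 => c | .d2 => d | .f2 => f | l => m l

theorem colAlt_four (T : Tensor8 V) (m : Label → V) :
    colAlt {.b2, .c2, .d2, .f2} T m
      = alt4 (fun b c d f => T (put m b c d f)) (m .b2) (m .c2) (m .d2) (m .f2) := by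
  let A : Finset Label := {.b2, .c2, .d2, .f2}
  let φ : Fin 4 ≃ {l // l ∈ A} :=
    ⟨![⟨.b2, by decide⟩, ⟨.c2, by decide⟩, ⟨.d2, by decide⟩, ⟨.f2, by decide⟩],
      fun l => match l.1 with | .b2 => 0 | .c2 => 1 | .d2 => 2 | _ => 3,
      by decide, by decide⟩
  refine Eq.trans ?_ (sum_perm_fin_four (fun b c d f => T (put m b c d f)) (fun i => m (φ i)))
  rw [colAlt, ← Equiv.sum_comp φ.permCongr]
  refine Finset.sum_congr rfl fun σ _ => ?_
  rw [Equiv.Perm.sign_permCongr]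
  congr 2
  funext l
  have key : ∀ i, Equiv.Perm.ofSubtype (φ.permCongr σ) (φ i : Label) = φ (σ i) := fun i => by
    rw [Equiv.Perm.ofSubtype_apply_coe]; simp
  have out : ∀ l, l ∉ A → Equiv.Perm.ofSubtype (φ.permCongr σ) l = l := fun l hl =>
    Equiv.Perm.ofSubtype_apply_of_not_mem _ hl
  cases l
  · exact congrArg m (out _ (by decide))
  · exact congrArg m (key 0)
  · exact congrArg m (key 1)
  · exact congrArg m (out _ (by decide))
  · exact congrArg m (key 2)
  · exact congrArg m (out _ (by decide))
  · exact congrArg m (out _ (by decide))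
  · exact congrArg m (key 3)

theorem colAlt_three (T : Tensor8 V) (m : Label → V) :
    colAlt {.c2, .d2, .f2} T m
      = alt3 (fun c d f => T (put m (m .b2) c d f)) (m .c2) (m .d2) (m .f2) := by
  let A : Finset Label := {.c2, .d2, .f2}
  let φ : Fin 3 ≃ {l // l ∈ A} :=
    ⟨![⟨.c2, by decide⟩, ⟨.d2, by decide⟩, ⟨.f2, by decide⟩],
      fun l => match l.1 with | .c2 => 0 | .d2 => 1 | _ => 2,
      by decide, by decide⟩
  refine Eq.trans ?_
    (sum_perm_fin_three (fun c d f => T (put m (m .b2) c d f)) (fun i => m (φ i)))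
  rw [colAlt, ← Equiv.sum_comp φ.permCongr]
  refine Finset.sum_congr rfl fun σ _ => ?_
  rw [Equiv.Perm.sign_permCongr]
  congr 2
  funext l
  have key : ∀ i, Equiv.Perm.ofSubtype (φ.permCongr σ) (φ i : Label) = φ (σ i) := fun i => by
    rw [Equiv.Perm.ofSubtype_apply_coe]; simp
  have out : ∀ l, l ∉ A → Equiv.Perm.ofSubtype (φ.permCongr σ) l = l := fun l hl =>
    Equiv.Perm.ofSubtype_apply_of_not_mem _ hl
  cases l
  · exact congrArg m (out _ (by decide))
  · exact congrArg m (out _ (by decide))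
  · exact congrArg m (key 0)
  · exact congrArg m (out _ (by decide))
  · exact congrArg m (key 1)
  · exact congrArg m (out _ (by decide))
  · exact congrArg m (out _ (by decide))
  · exact congrArg m (key 2)

/-- The alternation over four indices is a signed sum of alternations over three, one for each
choice of the entry in b₂. -/
theorem colAlt_four_eq_zero_of_three {T : Tensor8 V} (h : colAlt {.c2, .d2, .f2} T = 0) :
    colAlt {.b2, .c2, .d2, .f2} T = 0 := by
  have key : ∀ (m : Label → V) b c d f, alt3 (fun c d f => T (put m b c d f)) c d f = 0 := by
    intro m b c d f
    have e : ∀ c' d' f', put (put m b c d f) b c' d' f' = put m b c' d' f' := fun _ _ _ => by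
      funext l; cases l <;> rfl
    simpa only [colAlt_three, put, e, Pi.zero_apply] using congrFun h (put m b c d f)
  funext m
  rw [colAlt_four, alt4, key, key, key, key]
  simp

end Labels

/-! ### Polarisation of symmetrised multilinear forms -/

section Polarization

variable {V : Type*} [AddCommGroup V] [Module ℝ V]

/-- A symmetrised multilinear form that vanishes on the diagonal is zero. -/
theorem sum_perm_eq_zero_of_diag {B : Type*} [Fintype B] [DecidableEq B]
    (Ψ : MultilinearMap ℝ (fun _ : B => V) ℝ) (h : ∀ x, Ψ (fun _ => x) = 0) (v : B → V) :
    ∑ σ : Equiv.Perm B, Ψ (v ∘ σ) = 0 := by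
  -- Inclusion-exclusion: after expanding, only the selections r : B → B that use every v j survive,
  -- and on a finite set these are the permutations.
  have h1 : ∑ s : Finset B, (-1 : ℝ) ^ s.card * Ψ (fun _ => ∑ j, if j ∈ s then 0 else v j) = 0 :=
    Finset.sum_eq_zero fun s _ => by rw [h, mul_zero]
  have h2 : ∀ s : Finset B, Ψ (fun _ => ∑ j, if j ∈ s then 0 else v j)
      = ∑ r : B → B, (∏ i, if r i ∈ s then (0 : ℝ) else 1) * Ψ (v ∘ r) := by
    intro s
    rw [Ψ.map_sum]
    refine Finset.sum_congr rfl fun r _ => ?_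
    rw [← smul_eq_mul, ← Ψ.map_smul_univ]
    congr 1
    funext i
    by_cases hi : r i ∈ s <;> simp [hi]
  -- A set s contributes to r exactly when it avoids the range of r, so this is an alternating sum
  -- over the subsets of the complement of the range.
  have h3 : ∀ r : B → B, ∑ s : Finset B,
      (-1 : ℝ) ^ s.card * ∏ i, (if r i ∈ s then (0 : ℝ) else 1)
        = if Function.Surjective r then 1 else 0 := by
    intro r
    have e : ∀ s : Finset B, (∏ i, (if r i ∈ s then (0 : ℝ) else 1))
        = if s ⊆ (Finset.univ.image r)ᶜ then 1 else 0 := by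
      intro s
      split_ifs with hs
      · refine Finset.prod_eq_one fun i _ => if_neg fun hi => ?_
        have := hs hi
        simp at this
      · simp only [Finset.subset_iff, Finset.mem_compl, Finset.mem_image, Finset.mem_univ,
          true_and, not_forall, not_not] at hs
        obtain ⟨j, hj, i, rfl⟩ := hs
        exact Finset.prod_eq_zero (Finset.mem_univ i) (if_pos hj)
    simp only [e, mul_ite, mul_one, mul_zero]
    rw [← Finset.sum_filter]
    have e2 : (Finset.univ.filter fun s : Finset B => s ⊆ (Finset.univ.image r)ᶜ)
        = ((Finset.univ.image r)ᶜ).powerset := by ext; simp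
    rw [e2]
    have := Finset.sum_powerset_neg_one_pow_card (x := (Finset.univ.image r)ᶜ)
    have e3 : (Finset.univ.image r)ᶜ = ∅ ↔ Function.Surjective r := by
      rw [Finset.compl_eq_empty_iff, Finset.eq_univ_iff_forall]; simp [Function.Surjective]
    simp only [← e3]
    exact_mod_cast this
  simp only [h2, Finset.mul_sum] at h1
  rw [Finset.sum_comm] at h1
  simp only [← mul_assoc, ← Finset.sum_mul, h3, ite_mul, one_mul, zero_mul] at h1
  rw [← Finset.sum_filter] at h1
  rw [← h1]
  refine Finset.sum_bij (fun σ _ => σ) (fun σ _ => by simpa using σ.surjective)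
    (fun a _ b _ hab => Equiv.coe_fn_injective hab) (fun r hr => ?_) (fun _ _ => rfl)
  have hr' : Function.Surjective r := by simpa using hr
  exact ⟨Equiv.ofBijective r (Finite.surjective_iff_bijective.mp hr'), Finset.mem_univ _, rfl⟩

end Polarization

/-! ### Multilinear tensors with eight named indices -/

section Multilinear

variable {V : Type*} [AddCommGroup V] [Module ℝ V]

/-- `T` is a multilinear function of its eight arguments. -/
def IsMultilinear8 (T : Tensor8 V) : Prop :=
  ∃ f : MultilinearMap ℝ (fun _ : Label => V) ℝ, ∀ m, f m = T m

theorem IsMultilinear8.colAlt {T : Tensor8 V} (h : IsMultilinear8 T) (A : Finset Label) :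
    IsMultilinear8 (colAlt A T) := by
  obtain ⟨f, hf⟩ := h
  refine ⟨∑ π : Equiv.Perm {l // l ∈ A}, ((Equiv.Perm.sign π : ℤ) : ℝ) •
    f.domDomCongr (Equiv.Perm.ofSubtype π), fun m => ?_⟩
  rw [sum_apply]
  refine Finset.sum_congr rfl fun π _ => ?_
  rw [smul_apply, MultilinearMap.domDomCongr_apply, hf]
  rfl

theorem IsMultilinear8.rowSym {T : Tensor8 V} (h : IsMultilinear8 T) (A : Finset Label) :
    IsMultilinear8 (rowSym A T) := by
  obtain ⟨f, hf⟩ := h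
  refine ⟨∑ π : Equiv.Perm {l // l ∈ A}, f.domDomCongr (Equiv.Perm.ofSubtype π), fun m => ?_⟩
  rw [sum_apply]
  refine Finset.sum_congr rfl fun π _ => ?_
  rw [MultilinearMap.domDomCongr_apply, hf]
  rfl

theorem IsMultilinear8.comp_basis_eq_zero_iff {ι : Type*} {T : Tensor8 V} (h : IsMultilinear8 T)
    (e : Module.Basis ι ℝ V) : (fun m : Label → ι => T (e ∘ m)) = 0 ↔ T = 0 := by
  obtain ⟨f, hf⟩ := h
  constructor
  · intro h0
    have : f = 0 := Module.Basis.ext_multilinear (fun _ => e) fun m => by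
      rw [hf]
      exact congrFun h0 m
    funext m
    rw [← hf, this]
    rfl
  · rintro rfl
    rfl

/-- With the entries outside B frozen, this is polarisation of the resulting multilinear form in the
entries of B. -/
theorem IsMultilinear8.rowSym_eq_zero {T : Tensor8 V} (hT : IsMultilinear8 T) (B : Finset Label)
    (h : ∀ m x, (∀ l ∈ B, m l = x) → T m = 0) : KillingCSC.rowSym B T = 0 := by
  obtain ⟨f, hf⟩ := hT
  funext m
  let Ψ := f.domDomRestrict (fun l => l ∈ B) (fun l => m l)
  have := sum_perm_eq_zero_of_diag Ψ (fun x => by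
    rw [MultilinearMap.domDomRestrict_apply, hf]
    exact h _ x fun l hl => dif_pos hl) (fun l => m l)
  rw [Pi.zero_apply, ← this]
  refine Finset.sum_congr rfl fun σ _ => ?_
  rw [MultilinearMap.domDomRestrict_apply, hf]
  congr 1
  funext l
  by_cases hl : l ∈ B
  · rw [dif_pos hl, Function.comp_apply, Equiv.Perm.ofSubtype_apply_of_mem _ hl]; rfl
  · rw [dif_neg hl, Function.comp_apply, Equiv.Perm.ofSubtype_apply_of_not_mem _ hl]

end Multilinear

/-! ### Evaluating row symmetrisers on constant and nearly constant rows -/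

section Evaluation

variable {V : Type*}

theorem colAlt_rowSym_comm {A B : Finset Label} (h : Disjoint A B) (T : Tensor8 V) :
    colAlt A (rowSym B T) = rowSym B (colAlt A T) := by
  funext m
  simp only [colAlt, rowSym, Finset.mul_sum]
  rw [Finset.sum_comm]
  refine Finset.sum_congr rfl fun σ _ => Finset.sum_congr rfl fun π _ => ?_
  congr 2
  funext l
  simp only [Function.comp_apply]
  congr 1
  by_cases hA : l ∈ A
  · have hB := Finset.disjoint_left.mp h hA
    have hA' := (Equiv.Perm.ofSubtype_apply_mem_iff_mem π l).mpr hA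
    rw [Equiv.Perm.ofSubtype_apply_of_not_mem σ hB,
      Equiv.Perm.ofSubtype_apply_of_not_mem σ (Finset.disjoint_left.mp h hA')]
  · rw [Equiv.Perm.ofSubtype_apply_of_not_mem π hA]
    by_cases hB : l ∈ B
    · have hB' := (Equiv.Perm.ofSubtype_apply_mem_iff_mem σ l).mpr hB
      rw [Equiv.Perm.ofSubtype_apply_of_not_mem π (Finset.disjoint_right.mp h hB')]
    · rw [Equiv.Perm.ofSubtype_apply_of_not_mem σ hB, Equiv.Perm.ofSubtype_apply_of_not_mem π hA]

theorem rowSym_of_const {B : Finset Label} (T : Tensor8 V) {m : Label → V} {x : V}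
    (h : ∀ l ∈ B, m l = x) : rowSym B T m = (B.card.factorial : ℝ) * T m := by
  have : ∀ π : Equiv.Perm {l // l ∈ B}, m ∘ Equiv.Perm.ofSubtype π = m := fun π => by
    funext l
    by_cases hl : l ∈ B
    · rw [Function.comp_apply, h _ ((Equiv.Perm.ofSubtype_apply_mem_iff_mem π l).mpr hl), h _ hl]
    · rw [Function.comp_apply, Equiv.Perm.ofSubtype_apply_of_not_mem _ hl]
  simp only [rowSym, this, Finset.sum_const, Finset.card_univ, Fintype.card_perm,
    Fintype.card_coe, nsmul_eq_mul]

theorem card_mul_sum_perm_apply {B : Type*} [Fintype B] [DecidableEq B] (F : B → ℝ) (a : B) :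
    (Fintype.card B : ℝ) * ∑ π : Equiv.Perm B, F (π a)
      = ((Fintype.card B).factorial : ℝ) * ∑ l, F l := by
  have h : ∀ a', ∑ π : Equiv.Perm B, F (π a') = ∑ π : Equiv.Perm B, F (π a) := fun a' => by
    rw [← Equiv.sum_comp (Equiv.mulRight (Equiv.swap a a'))]
    simp
  calc (Fintype.card B : ℝ) * ∑ π : Equiv.Perm B, F (π a)
      = ∑ a', ∑ π : Equiv.Perm B, F (π a') := by simp [h]
    _ = ∑ π : Equiv.Perm B, ∑ a', F (π a') := Finset.sum_comm
    _ = ∑ π : Equiv.Perm B, ∑ l, F l := by simp only [fun π : Equiv.Perm B => Equiv.sum_comp π F]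
    _ = _ := by simp [Fintype.card_perm]

/-- All row entries other than that of b₂ equal x, so a permuted tensor depends only on where the
entry of b₂ lands, and each of the five places is reached by 4! = 24 permutations. -/
theorem rowSym_five (T : Tensor8 V) (m : Label → V) (x : V)
    (h : ∀ l ∈ ({.b1, .d1, .e1, .e2} : Finset Label), m l = x) :
    rowSym {.b2, .b1, .d1, .e1, .e2} T m = 24 * (T m + T (m ∘ Equiv.swap .b2 .b1)
      + T (m ∘ Equiv.swap .b2 .d1) + T (m ∘ Equiv.swap .b2 .e1) + T (m ∘ Equiv.swap .b2 .e2)) := by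
  let B : Finset Label := {.b2, .b1, .d1, .e1, .e2}
  have hB : ∀ l ∈ B, l ≠ .b2 → m l = x := fun l hl hl2 => h l (by
    revert hl hl2; cases l <;> decide)
  let a : {l // l ∈ B} := ⟨.b2, by decide⟩
  have key := card_mul_sum_perm_apply (fun l : {l // l ∈ B} => T (m ∘ Equiv.swap .b2 l.1)) a
  have e : ∀ π : Equiv.Perm {l // l ∈ B},
      m ∘ Equiv.Perm.ofSubtype π = m ∘ Equiv.swap .b2 (π⁻¹ a).1 := fun π => by
    funext l
    simp only [Function.comp_apply]
    by_cases hl : l ∈ B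
    · rw [Equiv.Perm.ofSubtype_apply_of_mem _ hl]
      by_cases h1 : l = (π⁻¹ a).1
      · have : (⟨l, hl⟩ : {l // l ∈ B}) = π⁻¹ a := Subtype.ext h1
        rw [this, ← h1, Equiv.swap_apply_right]
        simp [a]
      · have h2 : (π ⟨l, hl⟩).1 ≠ .b2 := fun h2 => h1 (by
          have : π ⟨l, hl⟩ = a := Subtype.ext h2
          rw [← this]; simp)
        rw [hB _ (π ⟨l, hl⟩).2 h2]
        by_cases h3 : l = .b2
        · subst h3
          rw [Equiv.swap_apply_left, hB _ (π⁻¹ a).2 fun h4 => h1 h4.symm]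
        · rw [Equiv.swap_apply_of_ne_of_ne h3 h1, hB _ hl h3]
    · rw [Equiv.Perm.ofSubtype_apply_of_not_mem _ hl, Equiv.swap_apply_of_ne_of_ne]
      · rintro rfl; exact hl a.2
      · rintro rfl; exact hl (π⁻¹ a).2
  have e2 : rowSym B T m
      = ∑ π : Equiv.Perm {l // l ∈ B}, T (m ∘ Equiv.swap .b2 (π a).1) := by
    rw [← Equiv.sum_comp (Equiv.inv (Equiv.Perm {l // l ∈ B}))]
    exact Finset.sum_congr rfl fun π _ => by rw [e π]; rfl
  have hc : Fintype.card {l // l ∈ B} = 5 := by decide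
  have e3 : ∑ l : {l // l ∈ B}, T (m ∘ Equiv.swap .b2 l.1) = T m + T (m ∘ Equiv.swap .b2 .b1)
      + T (m ∘ Equiv.swap .b2 .d1) + T (m ∘ Equiv.swap .b2 .e1)
      + T (m ∘ Equiv.swap .b2 .e2) := by
    rw [Finset.sum_coe_sort B fun l => T (m ∘ Equiv.swap .b2 l)]
    simp [B, add_assoc]
  rw [e3, ← e2, hc] at key
  norm_num [Nat.factorial] at key
  change rowSym B T m = _
  linarith

end Evaluation

/-! ### Reduction of the index conditions to alternated cubics -/

section Reduction

variable {V : Type*}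

theorem alt3_rev (F : V → V → V → ℝ) (a b c : V) :
    alt3 (fun a b c => F a c b) a b c = -alt3 F a b c := by
  simp only [alt3]; ring

theorem alt4_const_mul (k : ℝ) (F : V → V → V → V → ℝ) (a b c d : V) :
    alt4 (fun a b c d => k * F a b c d) a b c d = k * alt4 F a b c d := by
  simp only [alt4, alt3]; ring

theorem alt4_rotate (F : V → V → V → V → ℝ) (a b c d : V) :
    alt4 (fun a b c d => F b c d a) a b c d = -alt4 F a b c d := by
  simp only [alt4, alt3]; ring

theorem alt4_of_swap_adj {F : V → V → V → V → ℝ} (h : ∀ a b c d, F a b c d = F c b a d)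
    (a b c d : V) : alt4 F a b c d = 0 := by
  simp only [alt4, alt3]
  linear_combination h a b c d - h a b d c - h a c b d + h a d b c + h a c d b - h a d c b
    - h b a c d + h b a d c - h b c d a + h b d c a - h c a d b + h c b d a

/-- The values of a tensor at `x` in the row except for one entry `b`, summed over the row. -/
def rowDeriv (T : Tensor8 V) (x b c d f : V) : ℝ :=
  T (put (fun _ => x) b c d f) + T (put (fun _ => x) b c d f ∘ Equiv.swap .b2 .b1)
    + T (put (fun _ => x) b c d f ∘ Equiv.swap .b2 .d1)
    + T (put (fun _ => x) b c d f ∘ Equiv.swap .b2 .e1)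
    + T (put (fun _ => x) b c d f ∘ Equiv.swap .b2 .e2)

theorem alt4_rowDeriv_of_hookAdjoint {T : Tensor8 V} (h : hookAdjoint T = 0) (x b c d f : V) :
    alt4 (rowDeriv T x) b c d f = 0 := by
  have h0 := congrFun h (put (fun _ => x) b c d f)
  have e : ∀ b' c' d' f', put (put (fun _ => x) b c d f) b' c' d' f'
      = put (fun _ => x) b' c' d' f' := fun _ _ _ _ => by
    funext l; cases l <;> rfl
  have r : ∀ b c d f, rowSym {.b2, .b1, .d1, .e1, .e2} T (put (fun _ => x) b c d f)
      = 24 * rowDeriv T x b c d f := fun b c d f => rowSym_five T _ x fun l hl => by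
    cases l <;> first | rfl | exact absurd hl (by decide)
  rw [hookAdjoint, colAlt_four] at h0
  simp only [e, r, put, alt4_const_mul, Pi.zero_apply] at h0
  linarith

variable [AddCommGroup V] [Module ℝ V]

theorem alt3sym5_eq_zero_iff {T : Tensor8 V} (hT : IsMultilinear8 T) :
    alt3sym5 T = 0 ↔ ∀ x c d f, alt3 (fun c d f => T (put (fun _ => x) x c d f)) c d f = 0 := by
  have hd : Disjoint ({.c2, .d2, .f2} : Finset Label) {.b2, .b1, .d1, .e1, .e2} := by decide
  constructor
  · intro h x c d f
    have h0 := congrFun h (put (fun _ => x) x c d f)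
    have hm : ∀ l ∈ ({.b2, .b1, .d1, .e1, .e2} : Finset Label),
        put (fun _ => x) x c d f l = x := fun l hl => by
      cases l <;> first | rfl | exact absurd hl (by decide)
    rw [alt3sym5, colAlt_rowSym_comm hd, rowSym_of_const _ hm, colAlt_three] at h0
    have e : ∀ c' d' f', put (put (fun _ => x) x c d f) x c' d' f'
        = put (fun _ => x) x c' d' f' := fun _ _ _ => by
      funext l; cases l <;> rfl
    refine (mul_eq_zero.mp h0).resolve_left (by positivity) |>.symm.trans ?_ |>.symm
    simp only [put, e]
  · intro h
    rw [alt3sym5, colAlt_rowSym_comm hd]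
    refine (hT.colAlt _).rowSym_eq_zero _ fun m x hm => ?_
    rw [colAlt_three]
    have e : ∀ c d f, put m (m .b2) c d f = put (fun _ => x) x c d f := fun c d f => by
      funext l
      cases l <;> first | rfl | exact hm _ (by decide)
    simp only [e]
    exact h _ _ _ _

theorem alt4sym4_eq_zero_iff {T : Tensor8 V} (hT : IsMultilinear8 T) :
    alt4sym4 T = 0 ↔
      ∀ x b c d f, alt4 (fun b c d f => T (put (fun _ => x) b c d f)) b c d f = 0 := by
  have hd : Disjoint ({.b2, .c2, .d2, .f2} : Finset Label) {.b1, .d1, .e1, .e2} := by decide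
  constructor
  · intro h x b c d f
    have h0 := congrFun h (put (fun _ => x) b c d f)
    have hm : ∀ l ∈ ({.b1, .d1, .e1, .e2} : Finset Label),
        put (fun _ => x) b c d f l = x := fun l hl => by
      cases l <;> first | rfl | exact absurd hl (by decide)
    rw [alt4sym4, colAlt_rowSym_comm hd, rowSym_of_const _ hm, colAlt_four] at h0
    have e : ∀ b' c' d' f', put (put (fun _ => x) b c d f) b' c' d' f'
        = put (fun _ => x) b' c' d' f' := fun _ _ _ _ => by
      funext l; cases l <;> rfl
    refine (mul_eq_zero.mp h0).resolve_left (by positivity) |>.symm.trans ?_ |>.symm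
    simp only [put, e]
  · intro h
    rw [alt4sym4, colAlt_rowSym_comm hd]
    refine (hT.colAlt _).rowSym_eq_zero _ fun m x hm => ?_
    rw [colAlt_four]
    have e : ∀ b c d f, put m b c d f = put (fun _ => x) b c d f := fun b c d f => by
      funext l
      cases l <;> first | rfl | exact hm _ (by decide)
    simp only [e]
    exact h _ _ _ _ _

/-- The cubic in a curvature tensor as a tensor with eight named indices, for an assignment of
index names to the slots. -/
def cubicTensor (S : Tensor4 V) (br : V →ₗ[ℝ] V →ₗ[ℝ] V →ₗ[ℝ] V)
    (p q r s t u v w : Label) : Tensor8 V := fun m =>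
  S (br (m p) (m q) (m r)) (m s) (br (m u) (m v) (m w)) (m t)

/-- The cubic in a curvature tensor as a multilinear map. -/
def cubicMultilinear (S : Tensor4 V) (br : V →ₗ[ℝ] V →ₗ[ℝ] V →ₗ[ℝ] V) :
    MultilinearMap ℝ (fun _ : Label => V) ℝ where
  toFun m := S (br (m .b1) (m .b2) (m .c2)) (m .d1) (br (m .e1) (m .e2) (m .f2)) (m .d2)
  map_update_add' := by
    intro inst m i y z
    cases i <;> simp
  map_update_smul' := by
    intro inst m i y z
    cases i <;> simp

/-- The assignment of index names to the slots of a cubic. -/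
def slots (p q r s t u v w : Label) : Label → Label
  | .b1 => p | .b2 => q | .c2 => r | .d1 => s | .d2 => t | .e1 => u | .e2 => v | .f2 => w

theorem cubicTensor_isMultilinear (S : Tensor4 V) (br : V →ₗ[ℝ] V →ₗ[ℝ] V →ₗ[ℝ] V)
    {p q r s t u v w : Label} (h : Function.Injective (slots p q r s t u v w)) :
    IsMultilinear8 (cubicTensor S br p q r s t u v w) :=
  ⟨(cubicMultilinear S br).domDomCongr
    (Equiv.ofBijective _ (Finite.injective_iff_bijective.mp h)), fun _ => rfl⟩

variable {S : Tensor4 V} {br : V →ₗ[ℝ] V →ₗ[ℝ] V →ₗ[ℝ] V}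

theorem alt3sym5_cubicTensor_left (S : Tensor4 V) (br : V →ₗ[ℝ] V →ₗ[ℝ] V →ₗ[ℝ] V) :
    alt3sym5 (cubicTensor S br .c2 .d1 .d2 .b1 .b2 .f2 .e1 .e2) = 0 ↔
      ∀ x a b c, alt3 (cubU S br x) a b c = 0 :=
  alt3sym5_eq_zero_iff (cubicTensor_isMultilinear S br (by decide))

theorem alt3sym5_cubicTensor_mid (S : Tensor4 V) (br : V →ₗ[ℝ] V →ₗ[ℝ] V →ₗ[ℝ] V) :
    alt3sym5 (cubicTensor S br .c2 .b1 .b2 .d1 .d2 .f2 .e1 .e2) = 0 ↔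
      ∀ x a b c, alt3 (cubW S br x) a b c = 0 := by
  rw [alt3sym5_eq_zero_iff (cubicTensor_isMultilinear S br (by decide))]
  refine forall_congr' fun x => forall_congr' fun c => forall_congr' fun d =>
    forall_congr' fun f => ?_
  rw [← neg_eq_zero (a := alt3 (cubW S br x) c d f), ← alt3_rev (cubW S br x) c d f]
  exact Iff.rfl

/-- The row sum contains A, B, twice C and a term symmetric in two alternated vectors. Its
alternation is -(Alt A + Alt B + 2 Alt C), which equals 4 Alt B. -/
theorem alt4_cubB_of_hookAdjoint_left (hS : IsSymCurvatureTensor S) (hbr : IsContraction S br)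
    (hF : AlgFirst S br)
    (h : hookAdjoint (cubicTensor S br .c2 .d1 .d2 .b1 .b2 .f2 .e1 .e2) = 0) (x b c d f : V) :
    alt4 (cubB S br x) b c d f = 0 := by
  have h0 := alt4_rowDeriv_of_hookAdjoint h x b c d f
  have e : ∀ b c d f, rowDeriv (cubicTensor S br .c2 .d1 .d2 .b1 .b2 .f2 .e1 .e2) x b c d f
      = cubA S br x c d f b + cubB S br x c d f b + S (br c b d) x (br f x x) x
        + 2 * cubC S br x c d f b := fun b c d f => by
    change cubA S br x c d f b + cubB S br x c d f b + S (br c b d) x (br f x x) x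
      + S (br c x d) x (br f b x) x + cubC S br x c d f b = _
    rw [hbr.symm f x b, cubC]
    ring
  have hz := alt4_of_swap_adj (F := fun b c d f => S (br c b d) x (br f x x) x)
    (fun b c d f => by rw [hbr.symm]) b c d f
  have hA := hF.alt_cubA hS hbr x b c d f
  have hC := hF.alt_cubC hS hbr x b c d f
  generalize rowDeriv (cubicTensor S br .c2 .d1 .d2 .b1 .b2 .f2 .e1 .e2) x = D at *
  generalize cubA S br x = A at *
  generalize cubB S br x = B at *
  generalize cubC S br x = C at *
  generalize hZf : (fun b c d f => S (br c b d) x (br f x x) x) = Z at *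
  have eZ : ∀ b c d f, S (br c b d) x (br f x x) x = Z b c d f := fun b c d f => by rw [← hZf]
  simp only [eZ] at e
  clear eZ hZf h
  simp only [alt3, alt4, e] at *
  linear_combination (h0 - hz + 3 * hA + hC) / 4

/-- Here the alternated row sum is 2 Alt A + Alt E - 2 Alt B, which equals -8 Alt B. -/
theorem alt4_cubB_of_hookAdjoint_mid (hS : IsSymCurvatureTensor S) (hbr : IsContraction S br)
    (hF : AlgFirst S br)
    (h : hookAdjoint (cubicTensor S br .c2 .b1 .b2 .d1 .d2 .f2 .e1 .e2) = 0) (x b c d f : V) :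
    alt4 (cubB S br x) b c d f = 0 := by
  have h0 := alt4_rowDeriv_of_hookAdjoint h x b c d f
  have e : ∀ b c d f, rowDeriv (cubicTensor S br .c2 .b1 .b2 .d1 .d2 .f2 .e1 .e2) x b c d f
      = 2 * cubA S br x c b f d + cubE S br x c b f d + 2 * cubB S br x f b c d :=
      fun b c d f => by
    change S (br c x b) x (br f x x) d + S (br c b x) x (br f x x) d
      + S (br c x x) b (br f x x) d + S (br c x x) x (br f b x) d
      + S (br c x x) x (br f x b) d = _
    rw [hbr.symm f x b, hbr.symm c x b, hS.pair (br f x b) d, cubA, cubB, cubE]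
    ring
  have hA := hF.alt_cubA hS hbr x b c d f
  have hE := hF.alt_cubE hS hbr x b c d f
  generalize rowDeriv (cubicTensor S br .c2 .b1 .b2 .d1 .d2 .f2 .e1 .e2) x = D at *
  generalize cubA S br x = A at *
  generalize cubB S br x = B at *
  generalize cubE S br x = E at *
  clear h
  simp only [alt3, alt4, e] at *
  linear_combination -(h0 - 2 * hA - hE) / 8

theorem alt4sym4_cubicTensor_left (S : Tensor4 V) (br : V →ₗ[ℝ] V →ₗ[ℝ] V →ₗ[ℝ] V) :
    alt4sym4 (cubicTensor S br .c2 .d1 .d2 .b1 .b2 .f2 .e1 .e2) = 0 ↔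
      ∀ x b c d f, alt4 (cubA S br x) b c d f = 0 := by
  rw [alt4sym4_eq_zero_iff (cubicTensor_isMultilinear S br (by decide))]
  refine forall_congr' fun x => forall_congr' fun b => forall_congr' fun c =>
    forall_congr' fun d => forall_congr' fun f => ?_
  rw [← neg_eq_zero (a := alt4 (cubA S br x) b c d f), ← alt4_rotate (cubA S br x) b c d f]
  exact Iff.rfl

theorem alt4sym4_cubicTensor_mid (S : Tensor4 V) (br : V →ₗ[ℝ] V →ₗ[ℝ] V →ₗ[ℝ] V) :
    alt4sym4 (cubicTensor S br .c2 .d1 .d2 .b2 .b1 .f2 .e1 .e2) = 0 ↔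
      ∀ x b c d f, alt4 (cubB S br x) b c d f = 0 := by
  rw [alt4sym4_eq_zero_iff (cubicTensor_isMultilinear S br (by decide))]
  refine forall_congr' fun x => forall_congr' fun b => forall_congr' fun c =>
    forall_congr' fun d => forall_congr' fun f => ?_
  rw [← neg_eq_zero (a := alt4 (cubB S br x) b c d f), ← alt4_rotate (cubB S br x) b c d f]
  exact Iff.rfl

theorem alt4sym4_cubicTensor_right (S : Tensor4 V) (br : V →ₗ[ℝ] V →ₗ[ℝ] V →ₗ[ℝ] V) :
    alt4sym4 (cubicTensor S br .c2 .d1 .d2 .e1 .e2 .f2 .b1 .b2) = 0 ↔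
      ∀ x b c d f, alt4 (cubC S br x) b c d f = 0 := by
  rw [alt4sym4_eq_zero_iff (cubicTensor_isMultilinear S br (by decide))]
  refine forall_congr' fun x => forall_congr' fun b => forall_congr' fun c =>
    forall_congr' fun d => forall_congr' fun f => ?_
  rw [← neg_eq_zero (a := alt4 (cubC S br x) b c d f), ← alt4_rotate (cubC S br x) b c d f]
  exact Iff.rfl

/-- Each contraction of R is a difference of two contractions of S. The product has four terms, all
with the same alternation up to the sign they carry, so the result is a nonzero multiple of Alt C.
-/
theorem alt4sym4_cubicTensor_curvature {R : Tensor4 V} {brR : V →ₗ[ℝ] V →ₗ[ℝ] V →ₗ[ℝ] V}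
    (hS : IsSymCurvatureTensor S) (hR : IsCurvatureTensor R)
    (hRS : ∀ x v w, R x v x w = S x x v w)
    (hbrR : ∀ x c d, brR x c d = (2 / 3 : ℝ) • (br c x d - br d x c)) :
    alt4sym4 (cubicTensor R brR .d1 .c2 .d2 .e1 .e2 .b1 .f2 .b2) = 0 ↔
      ∀ x b c d f, alt4 (cubC S br x) b c d f = 0 := by
  rw [alt4sym4_eq_zero_iff (cubicTensor_isMultilinear R brR (by decide))]
  refine forall_congr' fun x => forall_congr' fun b => forall_congr' fun c =>
    forall_congr' fun d => forall_congr' fun f => ?_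
  -- The constant is -2 · (2/3)²: the factor -2 from moving x between the pairs of S, and 2/3 from
  -- each contraction.
  have e : ∀ b c d f, cubicTensor R brR .d1 .c2 .d2 .e1 .e2 .b1 .f2 .b2
      (put (fun _ => x) b c d f) = (-8 / 9) * (cubC S br x c d f b - cubC S br x d c f b
        - cubC S br x c d b f + cubC S br x d c b f) := fun b c d f => by
    change R (brR x c d) x (brR x f b) x = _
    rw [hR.anti_left, hR.anti_right, hRS, hS.pair, hS.apply_mid, hbrR, hbrR]
    simp only [sub_eq_add_neg, ← neg_one_smul ℝ (br _ _ _), map_add, map_smul,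
      LinearMap.add_apply, LinearMap.smul_apply, smul_eq_mul, cubC]
    ring
  have h : alt4 (fun b c d f => cubicTensor R brR .d1 .c2 .d2 .e1 .e2 .b1 .f2 .b2
      (put (fun _ => x) b c d f)) b c d f = 32 / 9 * alt4 (cubC S br x) b c d f := by
    simp only [e]
    generalize cubC S br x = C
    simp only [alt4, alt3]
    ring
  rw [h]
  simp

/-- The equivalence of all forms of the second algebraic integrability condition. -/
theorem tfae_cubic {R : Tensor4 V} {brR : V →ₗ[ℝ] V →ₗ[ℝ] V →ₗ[ℝ] V}
    (hS : IsSymCurvatureTensor S) (hbr : IsContraction S br) (hF : AlgFirst S br)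
    (hR : IsCurvatureTensor R) (hRS : ∀ x v w, R x v x w = S x x v w)
    (hbrR : ∀ x c d, brR x c d = (2 / 3 : ℝ) • (br c x d - br d x c)) :
    List.TFAE [
      ∀ x a b c, alt3 (cubU S br x) a b c = 0,
      hookAdjoint (cubicTensor S br .c2 .d1 .d2 .b1 .b2 .f2 .e1 .e2) = 0,
      hookAdjoint (cubicTensor S br .c2 .b1 .b2 .d1 .d2 .f2 .e1 .e2) = 0,
      alt3sym5 (cubicTensor S br .c2 .d1 .d2 .b1 .b2 .f2 .e1 .e2) = 0,
      alt3sym5 (cubicTensor S br .c2 .b1 .b2 .d1 .d2 .f2 .e1 .e2) = 0,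
      alt4sym4 (cubicTensor S br .c2 .d1 .d2 .b1 .b2 .f2 .e1 .e2) = 0,
      alt4sym4 (cubicTensor S br .c2 .d1 .d2 .b2 .b1 .f2 .e1 .e2) = 0,
      alt4sym4 (cubicTensor S br .c2 .d1 .d2 .e1 .e2 .f2 .b1 .b2) = 0,
      alt4sym4 (cubicTensor R brR .d1 .c2 .d2 .e1 .e2 .b1 .f2 .b2) = 0] := by
  have hA := hF.alt_cubA hS hbr
  have hC : ∀ x b c d f, alt4 (cubC S br x) b c d f = -3 / 2 * alt4 (cubB S br x) b c d f :=
    fun x b c d f => by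
      have h := hF.alt_cubC hS hbr x b c d f
      rw [hA] at h
      linarith
  have hW := hF.alt_cubW hS hbr
  -- The alternation of B with x inserted is -1 + (3/2) · 2 = 2 times that of U.
  have hB : (∀ x b c d f, alt4 (cubB S br x) b c d f = 0) →
      ∀ x a b c, alt3 (cubU S br x) a b c = 0 := fun h x a b c => by
    have h1 := alt4_cubB_self hS hbr x a b c
    rw [h, hW] at h1
    linarith
  tfae_have 1 ↔ 4 := (alt3sym5_cubicTensor_left S br).symm
  tfae_have 1 ↔ 5 := by
    rw [alt3sym5_cubicTensor_mid]
    simp [hW]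
  tfae_have 4 → 2 := fun h => colAlt_four_eq_zero_of_three h
  tfae_have 5 → 3 := fun h => colAlt_four_eq_zero_of_three h
  tfae_have 2 → 7 := fun h =>
    (alt4sym4_cubicTensor_mid S br).mpr (alt4_cubB_of_hookAdjoint_left hS hbr hF h)
  tfae_have 3 → 7 := fun h =>
    (alt4sym4_cubicTensor_mid S br).mpr (alt4_cubB_of_hookAdjoint_mid hS hbr hF h)
  tfae_have 7 → 1 := fun h => hB ((alt4sym4_cubicTensor_mid S br).mp h)
  tfae_have 6 ↔ 7 := by
    rw [alt4sym4_cubicTensor_left, alt4sym4_cubicTensor_mid]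
    simp [hA]
  tfae_have 8 ↔ 7 := by
    rw [alt4sym4_cubicTensor_right, alt4sym4_cubicTensor_mid]
    simp [hC]
  tfae_have 8 ↔ 9 := by
    rw [alt4sym4_cubicTensor_right, alt4sym4_cubicTensor_curvature hS hR hRS hbrR]
  tfae_finish

end Reduction

/-! ### Raising indices and the contraction with ḡ -/

theorem sum_rearrange {ι : Type*} [Fintype ι] (G : Matrix ι ι ℝ) (F : ι → ι → ℝ) (α β : ι → ℝ) :
    ∑ j, ∑ k, α j * β k * ∑ p, ∑ q, G j p * G k q * F p q
      = ∑ k, ∑ q, β k * G k q * ∑ j, ∑ p, α j * G j p * F p q := by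
  rw [Finset.sum_comm]
  refine Finset.sum_congr rfl fun k _ => ?_
  simp only [Finset.mul_sum]
  rw [Finset.sum_comm (s := Finset.univ (α := ι)) (t := Finset.univ (α := ι))
    (f := fun q j => ∑ p, β k * G k q * (α j * G j p * F p q))]
  refine Finset.sum_congr rfl fun j _ => ?_
  rw [Finset.sum_comm]
  refine Finset.sum_congr rfl fun q _ => Finset.sum_congr rfl fun p _ => ?_
  ring

section Raising

variable {V : Type*} [NormedAddCommGroup V] [NormedSpace ℝ V]

/-- The orthogonal projection defining the form `ḡ`. -/
def StandardModel.proj (g : LinearMap.BilinForm ℝ V) : StandardModel V → V →ₗ[ℝ] V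
  | sphere => LinearMap.id
  | hyperplane u => LinearMap.id - (g u u)⁻¹ • (LinearMap.flip g u).smulRight u

theorem StandardModel.gbar_eq (g : LinearMap.BilinForm ℝ V) (M : StandardModel V) (v w : V)
    (hsymm : g.IsSymm) : M.gbar g v w = g (M.proj g v) w := by
  cases M with
  | sphere => rfl
  | hyperplane u =>
    simp only [gbar, proj, LinearMap.sub_apply, LinearMap.id_apply, LinearMap.smul_apply,
      LinearMap.smulRight_apply, LinearMap.flip_apply, map_sub, map_smul, smul_eq_mul]
    rw [show g w u = g u w from hsymm.eq w u]
    ring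

theorem StandardModel.proj_selfAdjoint (g : LinearMap.BilinForm ℝ V) (M : StandardModel V)
    (hsymm : g.IsSymm) (v w : V) : g (M.proj g v) w = g v (M.proj g w) := by
  cases M with
  | sphere => rfl
  | hyperplane u =>
    have : g w u = g u w := hsymm.eq w u
    simp only [proj, LinearMap.sub_apply, LinearMap.id_apply, LinearMap.smul_apply,
      LinearMap.smulRight_apply, LinearMap.flip_apply, map_sub, map_smul, smul_eq_mul, this]
    ring

theorem StandardModel.proj_proj (g : LinearMap.BilinForm ℝ V) (M : StandardModel V)
    (hM : M.IsAdmissible g) (v : V) : M.proj g (M.proj g v) = M.proj g v := by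
  cases M with
  | sphere => rfl
  | hyperplane u =>
    have hu : g u u ≠ 0 := hM
    simp only [proj, LinearMap.id_apply, LinearMap.smul_apply,
      LinearMap.smulRight_apply, LinearMap.flip_apply, smul_smul, sub_eq_add_neg, ← neg_smul,
      map_add, map_smul, LinearMap.add_apply]
    have h0 : u + (-(g u u)⁻¹ * g u u) • u = 0 := by
      rw [neg_mul, inv_mul_cancel₀ hu, neg_smul, one_smul, add_neg_cancel]
    rw [h0, smul_zero, add_zero]

variable {ι : Type*} [Fintype ι] [DecidableEq ι]

/-- The vector with components `g^{ip} φ_p`. -/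
def raise (g : LinearMap.BilinForm ℝ V) (e : Module.Basis ι ℝ V) : (V →ₗ[ℝ] ℝ) →ₗ[ℝ] V where
  toFun φ := ∑ i, ∑ p, (metricInv g e i p * φ (e p)) • e i
  map_add' φ ψ := by
    simp only [LinearMap.add_apply, mul_add, add_smul, Finset.sum_add_distrib]
  map_smul' c φ := by
    simp only [LinearMap.smul_apply, smul_eq_mul, RingHom.id_apply, Finset.smul_sum, smul_smul]
    simp only [mul_left_comm]

theorem raise_apply (g : LinearMap.BilinForm ℝ V) (e : Module.Basis ι ℝ V) (φ : V →ₗ[ℝ] ℝ) :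
    raise g e φ = ∑ i, ∑ p, (metricInv g e i p * φ (e p)) • e i := rfl

theorem gram_isUnit_det {g : LinearMap.BilinForm ℝ V} (hnondeg : g.Nondegenerate)
    (e : Module.Basis ι ℝ V) : IsUnit (Matrix.of fun a b => g (e a) (e b)).det := by
  have h := (LinearMap.BilinForm.nondegenerate_iff_det_ne_zero (B := g) e).mp hnondeg
  have e1 : LinearMap.BilinForm.toMatrix e g = Matrix.of fun a b => g (e a) (e b) := by
    ext a b; simp
  rw [e1] at h
  exact isUnit_iff_ne_zero.mpr h

theorem metricInv_symm {g : LinearMap.BilinForm ℝ V} (hsymm : g.IsSymm)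
    (e : Module.Basis ι ℝ V) (i p : ι) : metricInv g e i p = metricInv g e p i := by
  have h : (Matrix.of fun a b => g (e a) (e b)).transpose
      = Matrix.of fun a b => g (e a) (e b) := by
    ext a b; exact hsymm.eq (e b) (e a)
  have h2 := Matrix.transpose_nonsing_inv (Matrix.of fun a b => g (e a) (e b))
  rw [h] at h2
  exact congrFun (congrFun h2 p) i

theorem apply_raise {g : LinearMap.BilinForm ℝ V} (hsymm : g.IsSymm) (hnondeg : g.Nondegenerate)
    (e : Module.Basis ι ℝ V) (φ : V →ₗ[ℝ] ℝ) (v : V) : g (raise g e φ) v = φ v := by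
  suffices h : g (raise g e φ) = φ by rw [h]
  refine e.ext fun q => ?_
  have hinv := Matrix.nonsing_inv_mul _ (gram_isUnit_det hnondeg e)
  have hpq : ∀ p, ∑ i, metricInv g e p i * g (e i) (e q) = if p = q then 1 else 0 := fun p => by
    have := congrFun (congrFun hinv p) q
    rw [Matrix.one_apply, Matrix.mul_apply] at this
    exact this
  rw [raise_apply]
  simp only [map_sum, map_smul, LinearMap.sum_apply, LinearMap.smul_apply, smul_eq_mul]
  rw [Finset.sum_comm]
  calc ∑ p, ∑ i, metricInv g e i p * φ (e p) * g (e i) (e q)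
      = ∑ p, φ (e p) * ∑ i, metricInv g e p i * g (e i) (e q) := by
        refine Finset.sum_congr rfl fun p _ => ?_
        rw [Finset.mul_sum]
        refine Finset.sum_congr rfl fun i _ => ?_
        rw [metricInv_symm hsymm e i p]
        ring
    _ = φ (e q) := by simp [hpq]

theorem raise_self {g : LinearMap.BilinForm ℝ V} (hsymm : g.IsSymm) (hnondeg : g.Nondegenerate)
    (e : Module.Basis ι ℝ V) (v : V) : raise g e (g v) = v := by
  have h : ∀ w, g (raise g e (g v) - v) w = 0 := fun w => by
    rw [map_sub, LinearMap.sub_apply, apply_raise hsymm hnondeg, sub_self]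
  exact sub_eq_zero.mp (hnondeg.1 _ h)

/-- The contraction `P^i_j T^j_{pqr}` of a tensor with the projection `P`. -/
def contraction (g : LinearMap.BilinForm ℝ V) (M : StandardModel V) (e : Module.Basis ι ℝ V)
    (T : Tensor4 V) : V →ₗ[ℝ] V →ₗ[ℝ] V →ₗ[ℝ] V :=
  LinearMap.mk₂ ℝ (fun p q => M.proj g ∘ₗ raise g e ∘ₗ ((T.flip p).flip q).flip)
    (fun _ _ _ => by
      ext r
      simp only [LinearMap.comp_apply, LinearMap.add_apply, ← map_add]
      congr 2; ext y; simp)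
    (fun _ _ _ => by
      ext r
      simp only [LinearMap.comp_apply, LinearMap.smul_apply, ← map_smul]
      congr 2; ext y; simp)
    (fun _ _ _ => by
      ext r
      simp only [LinearMap.comp_apply, LinearMap.add_apply, ← map_add]
      congr 2; ext y; simp)
    (fun _ _ _ => by
      ext r
      simp only [LinearMap.comp_apply, LinearMap.smul_apply, ← map_smul]
      congr 2; ext y; simp)

theorem contraction_apply (g : LinearMap.BilinForm ℝ V) (M : StandardModel V)
    (e : Module.Basis ι ℝ V) (T : Tensor4 V) (p q r : V) :
    contraction g M e T p q r = M.proj g (raise g e (((T.flip p).flip q).flip r)) := rfl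

theorem apply_contraction {g : LinearMap.BilinForm ℝ V} (hsymm : g.IsSymm)
    (hnondeg : g.Nondegenerate) (M : StandardModel V) (e : Module.Basis ι ℝ V) (T : Tensor4 V)
    (p q r y : V) : g (contraction g M e T p q r) y = T (M.proj g y) p q r := by
  rw [contraction_apply, M.proj_selfAdjoint g hsymm, apply_raise hsymm hnondeg]
  rfl

theorem proj_contraction {g : LinearMap.BilinForm ℝ V} {M : StandardModel V}
    (hM : M.IsAdmissible g) (e : Module.Basis ι ℝ V) (T : Tensor4 V) (p q r : V) :
    M.proj g (contraction g M e T p q r) = contraction g M e T p q r :=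
  M.proj_proj g hM _

/-- For `adj`, contractions are fixed by P, and S(y,p,q,r) = g(br(p,q,r), y) whenever P y = y. The
two sides are therefore one g-product of two contractions. -/
theorem contraction_isContraction {g : LinearMap.BilinForm ℝ V} (hsymm : g.IsSymm)
    (hnondeg : g.Nondegenerate) {M : StandardModel V} (hM : M.IsAdmissible g)
    (e : Module.Basis ι ℝ V) {S : Tensor4 V} (hS : IsSymCurvatureTensor S) :
    IsContraction S (contraction g M e S) where
  symm p q r := by
    simp only [contraction_apply]
    congr 2; ext y; exact hS.symm_right _ _ _ _
  cyclic p q r := by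
    simp only [contraction_apply, ← map_add]
    have : ((S.flip p).flip q).flip r + ((S.flip q).flip r).flip p
        + ((S.flip r).flip p).flip q = 0 := by
      ext y
      have h := hS.bianchi y p q r
      simp only [LinearMap.add_apply, LinearMap.flip_apply, LinearMap.zero_apply]
      linarith
    rw [this, map_zero, map_zero]
  adj p q r s t u := by
    have key : ∀ p q r y, M.proj g y = y → S y p q r = g (contraction g M e S p q r) y :=
      fun p q r y hy => by rw [apply_contraction hsymm hnondeg, hy]
    rw [key _ _ _ _ (proj_contraction hM e S _ _ _), key _ _ _ _ (proj_contraction hM e S _ _ _)]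
    exact hsymm.eq _ _

/-- Each ḡ is absorbed into an outer factor: ḡ_{ij} T^i_{pqr} are the lowered components of the
contraction, and the inverse metric in the middle factor raises them again. -/
theorem cubic_eq {g : LinearMap.BilinForm ℝ V} (hsymm : g.IsSymm)
    (hnondeg : g.Nondegenerate) (M : StandardModel V)
    (e : Module.Basis ι ℝ V) (T : Tensor4 V) (p q r s t u v w : ι) :
    cubic g M e T p q r s t u v w
      = T (contraction g M e T (e p) (e q) (e r)) (e s)
        (contraction g M e T (e u) (e v) (e w)) (e t) := by
  have hc : ∀ p q r, contraction g M e T (e p) (e q) (e r)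
      = ∑ j, ∑ a, ((∑ i, M.gbar g (e i) (e j) * raiseFirst g e T i p q r)
        * metricInv g e j a) • e a := by
    intro p q r
    rw [← raise_self hsymm hnondeg e (contraction g M e T (e p) (e q) (e r)), raise_apply,
      Finset.sum_comm]
    refine Finset.sum_congr rfl fun j _ => Finset.sum_congr rfl fun a _ => ?_
    rw [metricInv_symm hsymm e a j, mul_comm]
    congr 2
    rw [contraction_apply, raise_apply, M.proj_selfAdjoint g hsymm]
    simp only [map_sum, map_smul, LinearMap.sum_apply, LinearMap.smul_apply, smul_eq_mul]
    refine Finset.sum_congr rfl fun i _ => ?_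
    rw [M.gbar_eq g _ _ hsymm, M.proj_selfAdjoint g hsymm, raiseFirst, Finset.mul_sum]
    refine Finset.sum_congr rfl fun b _ => ?_
    simp only [LinearMap.flip_apply]
    ring
  rw [hc, hc]
  have hg : ∀ i j, M.gbar g (e i) (e j) = M.gbar g (e j) (e i) := fun i j => by
    rw [M.gbar_eq g _ _ hsymm, M.gbar_eq g _ _ hsymm, M.proj_selfAdjoint g hsymm]
    exact hsymm.eq _ _
  have hL : cubic g M e T p q r s t u v w
      = ∑ j, ∑ k, (∑ i, M.gbar g (e i) (e j) * raiseFirst g e T i p q r)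
        * (∑ l, M.gbar g (e l) (e k) * raiseFirst g e T l u v w)
        * raiseFirstThird g e T j s k t := by
    rw [cubic, Finset.sum_comm]
    refine Finset.sum_congr rfl fun j _ => ?_
    rw [Finset.sum_comm]
    refine Finset.sum_congr rfl fun k _ => ?_
    rw [Finset.sum_mul_sum, Finset.sum_mul]
    refine Finset.sum_congr rfl fun i _ => ?_
    rw [Finset.sum_mul]
    refine Finset.sum_congr rfl fun l _ => ?_
    rw [hg k l]
    ring
  rw [hL]
  simp only [map_sum, map_smul, LinearMap.sum_apply, LinearMap.smul_apply, smul_eq_mul,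
    raiseFirstThird]
  exact sum_rearrange (metricInv g e) (fun p q => T (e p) (e s) (e q) (e t))
    (fun j => ∑ i, M.gbar g (e i) (e j) * raiseFirst g e T i p q r)
    (fun k => ∑ l, M.gbar g (e l) (e k) * raiseFirst g e T l u v w)

/-- Polarising the common quadratic form in x relates S to R with two slots symmetrised; the Bianchi
identity of R then isolates a single component. -/
theorem curvature_of_quadratic {R S : Tensor4 V} (hR : IsCurvatureTensor R)
    (hS : IsSymCurvatureTensor S) (hRS : ∀ x v w, R x v x w = S x x v w) (y x c d : V) :
    R y x c d = 2 / 3 * (S y c x d - S y d x c) := by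
  have pol : ∀ x y v w, R x v y w + R y v x w = 2 * S x y v w := by
    intro x y v w
    have h := hRS (x + y) v w
    simp only [map_add, LinearMap.add_apply, hRS] at h
    linarith [hS.symm_left x y v w]
  have h1 := pol y c x d
  have h2 := pol y d x c
  have h3 := hR.bianchi y x d c
  have h4 := hR.anti_right y x c d
  have h5 := hR.anti_right y c d x
  have h6 := hR.pair y d c x
  have h7 := hR.pair y c d x
  linarith

end Raising

/-! ### Polynomial functions on lines -/

section Polynomial

/-- Vector-valued polynomial functions of a real variable. -/
def IsPoly {W : Type*} [AddCommMonoid W] [Module ℝ W] (f : ℝ → W) : Prop :=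
  f ∈ Submodule.span ℝ {h : ℝ → W | ∃ (i : ℕ) (w : W), h = fun t => t ^ i • w}

variable {A B : Type*} [AddCommMonoid A] [Module ℝ A] [AddCommMonoid B] [Module ℝ B]

theorem IsPoly.const (a : A) : IsPoly fun _ => a :=
  Submodule.subset_span ⟨0, a, by simp⟩

theorem IsPoly.line (x y : A) : IsPoly fun t : ℝ => x + t • y :=
  Submodule.add_mem _ (IsPoly.const x) (Submodule.subset_span ⟨1, y, by simp⟩)

theorem IsPoly.app {f : ℝ → A →ₗ[ℝ] B} {g : ℝ → A} (hf : IsPoly f) (hg : IsPoly g) :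
    IsPoly fun t => f t (g t) := by
  unfold IsPoly at hf hg
  induction hf using Submodule.span_induction with
  | mem f hf =>
    obtain ⟨i, L, rfl⟩ := hf
    induction hg using Submodule.span_induction with
    | mem g hg =>
      obtain ⟨j, a, rfl⟩ := hg
      exact Submodule.subset_span ⟨i + j, L a, by
        funext t
        rw [LinearMap.smul_apply, map_smul, smul_smul, pow_add]⟩
    | zero => simpa using IsPoly.const (0 : B)
    | add g₁ g₂ _ _ h₁ h₂ =>
      have e : (fun t => (t ^ i • L) ((g₁ + g₂) t))
          = (fun t => (t ^ i • L) (g₁ t)) + fun t => (t ^ i • L) (g₂ t) := by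
        funext t; exact map_add _ _ _
      exact e ▸ Submodule.add_mem _ h₁ h₂
    | smul c g _ h =>
      have e : (fun t => (t ^ i • L) ((c • g) t)) = c • fun t => (t ^ i • L) (g t) := by
        funext t; exact map_smul _ _ _
      exact e ▸ Submodule.smul_mem _ c h
  | zero => simpa using IsPoly.const (0 : B)
  | add f₁ f₂ _ _ h₁ h₂ => exact Submodule.add_mem _ h₁ h₂
  | smul c f _ h => exact Submodule.smul_mem _ c h

theorem IsPoly.sub {f g : ℝ → ℝ} (hf : IsPoly f) (hg : IsPoly g) : IsPoly fun t => f t - g t :=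
  Submodule.sub_mem _ hf hg

theorem IsPoly.add {f g : ℝ → A} (hf : IsPoly f) (hg : IsPoly g) : IsPoly fun t => f t + g t :=
  Submodule.add_mem _ hf hg

theorem IsPoly.eq_zero {f : ℝ → ℝ} (hf : IsPoly f) {C : ℝ} (h : ∀ t, C < t → f t = 0) (t : ℝ) :
    f t = 0 := by
  have : ∃ p : Polynomial ℝ, ∀ t, f t = p.eval t := by
    clear h
    unfold IsPoly at hf
    induction hf using Submodule.span_induction with
    | mem f hf =>
      obtain ⟨i, w, rfl⟩ := hf
      exact ⟨Polynomial.C w * Polynomial.X ^ i, fun t => by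
        rw [Polynomial.eval_mul, Polynomial.eval_C, Polynomial.eval_pow, Polynomial.eval_X]
        exact mul_comm _ _⟩
    | zero => exact ⟨0, by simp⟩
    | add f₁ f₂ _ _ h₁ h₂ =>
      obtain ⟨p, hp⟩ := h₁
      obtain ⟨q, hq⟩ := h₂
      exact ⟨p + q, by simp [hp, hq]⟩
    | smul c f _ h =>
      obtain ⟨p, hp⟩ := h
      exact ⟨Polynomial.C c * p, by simp [hp]⟩
  obtain ⟨p, hp⟩ := this
  have hp0 : p = 0 := Polynomial.eq_zero_of_infinite_isRoot p <|
    (Set.Ioi_infinite C).mono fun t ht => by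
      rw [Set.mem_ofPred_eq, Polynomial.IsRoot, ← hp]
      exact h t ht
  rw [hp, hp0, Polynomial.eval_zero]

end Polynomial

/-! ### Extending identities from tangent vectors of M to all of V -/

section Extension

variable {V : Type*} [NormedAddCommGroup V] [NormedSpace ℝ V]

theorem StandardModel.carrier_nonempty {g : LinearMap.BilinForm ℝ V} {M : StandardModel V}
    (hM : M.IsAdmissible g) : (M.carrier g).Nonempty := by
  cases M with
  | sphere => exact hM
  | hyperplane u =>
    have hu : g u u ≠ 0 := hM
    exact ⟨(g u u)⁻¹ • u, by simp [carrier, hu]⟩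

/-- A homogeneous polynomial vanishing on `M` vanishes identically. -/
theorem StandardModel.eq_zero_of_homogeneous {g : LinearMap.BilinForm ℝ V} (hsymm : g.IsSymm)
    {M : StandardModel V} (hM : M.IsAdmissible g) {f : V → ℝ} {n : ℕ}
    (hhom : ∀ (c : ℝ) x, f (c • x) = c ^ n * f x) (hpoly : ∀ x y, IsPoly fun t : ℝ => f (x + t • y))
    (h : ∀ x ∈ M.carrier g, f x = 0) (y : V) : f y = 0 := by
  obtain ⟨x, hx⟩ := StandardModel.carrier_nonempty hM
  -- For all large t the point y + tx can be rescaled onto M. By homogeneity f vanishes there, so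
  -- the polynomial t ↦ f(y + tx) has infinitely many roots and vanishes at t = 0.
  have key : ∃ C : ℝ, ∀ t, C < t → ∃ c : ℝ, c ≠ 0 ∧ c • (y + t • x) ∈ M.carrier g := by
    cases M with
    | sphere =>
      have hx1 : g x x = 1 := hx
      -- Beyond this bound t² dominates g(y,y) + 2t g(y,x), so the vector has positive square and
      -- can be normalised even in indefinite signature.
      refine ⟨|g y y| + 2 * |g y x| + 1, fun t ht => ?_⟩
      have e : g (y + t • x) (y + t • x) = g y y + 2 * t * g y x + t ^ 2 := by
        have : g x y = g y x := hsymm.eq x y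
        simp only [map_add, map_smul, LinearMap.add_apply, LinearMap.smul_apply, smul_eq_mul,
          this, hx1]
        ring
      have hpos : 0 < g (y + t • x) (y + t • x) := by
        rw [e]
        have h1 := neg_abs_le (g y y)
        have h2 := neg_abs_le (g y x)
        have h3 := abs_nonneg (g y y)
        have h4 := abs_nonneg (g y x)
        nlinarith
      refine ⟨(√(g (y + t • x) (y + t • x)))⁻¹, by positivity, ?_⟩
      simp only [carrier, Set.mem_ofPred_eq]
      rw [map_smul, map_smul, LinearMap.smul_apply, smul_eq_mul, smul_eq_mul, ← mul_assoc,
        ← mul_inv, Real.mul_self_sqrt hpos.le, inv_mul_cancel₀ hpos.ne']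
    | hyperplane u =>
      have hx1 : g x u = 1 := hx
      refine ⟨-g y u, fun t ht => ?_⟩
      have e : g (y + t • x) u = g y u + t := by
        simp [hx1]
      have hne : g (y + t • x) u ≠ 0 := by rw [e]; linarith
      refine ⟨(g (y + t • x) u)⁻¹, inv_ne_zero hne, ?_⟩
      simp only [carrier, Set.mem_ofPred_eq]
      rw [map_smul, LinearMap.smul_apply, smul_eq_mul, inv_mul_cancel₀ hne]
  obtain ⟨C, hC⟩ := key
  have := (hpoly y x).eq_zero (C := C) (fun t ht => by
    obtain ⟨c, hc, hm⟩ := hC t ht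
    have h1 := h _ hm
    rw [hhom] at h1
    exact (mul_eq_zero.mp h1).resolve_left (pow_ne_zero _ hc)) 0
  simpa using this

theorem StandardModel.apply_normal {g : LinearMap.BilinForm ℝ V} {M : StandardModel V} {x : V}
    (hx : x ∈ M.carrier g) : g x (M.normal x) = 1 := by
  cases M <;> exact hx

theorem StandardModel.isTangent_sub {g : LinearMap.BilinForm ℝ V} {M : StandardModel V} {x : V}
    (hx : x ∈ M.carrier g) (a : V) : M.IsTangent g x (a - g a (M.normal x) • x) := by
  rw [IsTangent, map_sub, map_smul, LinearMap.sub_apply, LinearMap.smul_apply, smul_eq_mul,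
    apply_normal hx, mul_one, sub_self]

/-- An alternating form that is linear and annihilated by `x` vanishes if it does so on tangent
vectors. -/
theorem StandardModel.alt3_eq_zero_of_tangent {g : LinearMap.BilinForm ℝ V} {M : StandardModel V}
    {x : V} (hx : x ∈ M.carrier g) {F : V → V → V → ℝ}
    (hlin : ∀ (k : ℝ) a b c, alt3 F (a - k • x) b c = alt3 F a b c - k * alt3 F x b c)
    (hself : ∀ b c, alt3 F x b c = 0)
    (h : ∀ a b c, M.IsTangent g x a → M.IsTangent g x b → M.IsTangent g x c → alt3 F a b c = 0)
    (a b c : V) : alt3 F a b c = 0 := by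
  have swap : ∀ a b c, alt3 F a b c = -alt3 F b a c := fun a b c => by simp only [alt3]; ring
  have rot : ∀ a b c, alt3 F a b c = alt3 F b c a := fun a b c => by simp only [alt3]; ring
  have red : ∀ a b c, alt3 F (a - g a (M.normal x) • x) b c = alt3 F a b c := fun a b c => by
    rw [hlin, hself, mul_zero, sub_zero]
  rw [← red a, rot, ← red b, rot, ← red c, rot]
  exact h _ _ _ (isTangent_sub hx a) (isTangent_sub hx b) (isTangent_sub hx c)

/-- Both sides vanish when v or w is x, so on M the vectors may be replaced by tangent ones, where
both sides are g(K v, w). Homogeneity of degree 2 removes the restriction on x. -/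
theorem quadratic_eq {g : LinearMap.BilinForm ℝ V} (hsymm : g.IsSymm) {M : StandardModel V}
    (hM : M.IsAdmissible g) {K : V → V →ₗ[ℝ] V} {S R : Tensor4 V}
    (hS : IsSymCurvatureTensor S) (hKS : RepresentsS g M K S)
    (hR : IsCurvatureTensor R) (hKR : RepresentsR g M K R) (x v w : V) :
    R x v x w = S x x v w := by
  rw [← sub_eq_zero]
  refine StandardModel.eq_zero_of_homogeneous (f := fun x => R x v x w - S x x v w) (n := 2)
    hsymm hM (fun c x => ?_) (fun x y => ?_) (fun x hx => ?_) x
  · simp only [map_smul, LinearMap.smul_apply, smul_eq_mul]; ring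
  · exact (((((IsPoly.const R).app (.line x y)).app (.const v)).app (.line x y)).app
      (.const w)).sub
      (((((IsPoly.const S).app (.line x y)).app (.line x y)).app (.const v)).app (.const w))
  · have hRx : ∀ a b, R x x a b = 0 := fun a b => by have := hR.anti_left x x a b; linarith
    have hRx' : ∀ a b, R a b x x = 0 := fun a b => by rw [← hR.pair, hRx]
    have hSx : ∀ b, S x x b x = 0 := fun b => by rw [hS.symm_right, hS.apply_self]
    have h := (hKR x hx _ _ (M.isTangent_sub hx v) (M.isTangent_sub hx w)).symm.trans
      (hKS x hx _ _ (M.isTangent_sub hx v) (M.isTangent_sub hx w))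
    simp only [sub_eq_add_neg, ← neg_smul, map_add, map_smul, LinearMap.add_apply,
      LinearMap.smul_apply, hRx, hRx', hSx, hS.apply_self, smul_eq_mul, mul_zero, add_zero] at h
    exact sub_eq_zero.mpr h

variable {S : Tensor4 V} {br : V →ₗ[ℝ] V →ₗ[ℝ] V →ₗ[ℝ] V}

theorem algFirst_of_tangent {g : LinearMap.BilinForm ℝ V} (hsymm : g.IsSymm)
    {M : StandardModel V} (hM : M.IsAdmissible g) (hS : IsSymCurvatureTensor S)
    (hbr : IsContraction S br)
    (h : ∀ x ∈ M.carrier g, ∀ a b c, M.IsTangent g x a → M.IsTangent g x b → M.IsTangent g x c →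
      alt3 (fun a b c => S (br c x x) a x b) a b c = 0) : AlgFirst S br := by
  intro x a b c
  have hp : ∀ a b c x y, IsPoly fun t : ℝ =>
      S (br c (x + t • y) (x + t • y)) a (x + t • y) b := fun a b c x y =>
    ((((IsPoly.const S).app (((IsPoly.const (br c)).app (.line x y)).app (.line x y))).app
      (.const a)).app (.line x y)).app (.const b)
  refine StandardModel.eq_zero_of_homogeneous
    (f := fun x => alt3 (fun a b c => S (br c x x) a x b) a b c) (n := 3)
    hsymm hM (fun k x => ?_) (fun x y => ?_) (fun x hx => ?_) x
  · simp only [alt3, map_smul, LinearMap.smul_apply, smul_eq_mul]; ring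
  · exact (((((hp _ _ _ x y).sub (hp _ _ _ x y)).sub (hp _ _ _ x y)).add (hp _ _ _ x y)).add
      (hp _ _ _ x y)).sub (hp _ _ _ x y)
  · refine StandardModel.alt3_eq_zero_of_tangent hx (fun k a b c => ?_) (fun b c => ?_) (h x hx)
      a b c
    · simp only [alt3, sub_eq_add_neg a, ← neg_smul, map_add, map_smul, LinearMap.add_apply,
        LinearMap.smul_apply, smul_eq_mul]
      ring
    -- With x inserted only multiples of S(br(c,x,x),b,x,x) and of its b, c-exchange remain, and
    -- these two are equal by `adj`.
    · have e1 : ∀ b c, S (br c x x) x x b = -1 / 2 * S (br c x x) b x x := fun b c => by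
        have h1 := hS.apply_mid (br c x x) b x
        have h2 := hS.symm_right (br c x x) x x b
        linarith
      have e2 := hbr.adj c x x b x x
      simp only [alt3, e1, hbr.diag, map_zero, LinearMap.zero_apply]
      linarith

theorem alt_cubU_of_tangent {g : LinearMap.BilinForm ℝ V} (hsymm : g.IsSymm)
    {M : StandardModel V} (hM : M.IsAdmissible g) (hS : IsSymCurvatureTensor S)
    (hbr : IsContraction S br) (hF : AlgFirst S br)
    (h : ∀ x ∈ M.carrier g, ∀ a b c, M.IsTangent g x a → M.IsTangent g x b → M.IsTangent g x c →
      alt3 (cubU S br x) a b c = 0) (x a b c : V) : alt3 (cubU S br x) a b c = 0 := by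
  have hp : ∀ a b c x y, IsPoly fun t : ℝ => cubU S br (x + t • y) a b c := fun a b c x y =>
    ((((IsPoly.const S).app (((IsPoly.const (br a)).app (.line x y)).app (.const b))).app
      (.line x y)).app (((IsPoly.const (br c)).app (.line x y)).app (.line x y))).app (.line x y)
  refine StandardModel.eq_zero_of_homogeneous
    (f := fun x => alt3 (cubU S br x) a b c) (n := 5)
    hsymm hM (fun k x => ?_) (fun x y => ?_) (fun x hx => ?_) x
  · simp only [alt3, cubU, map_smul, LinearMap.smul_apply, smul_eq_mul]; ring
  · exact (((((hp _ _ _ x y).sub (hp _ _ _ x y)).sub (hp _ _ _ x y)).add (hp _ _ _ x y)).add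
      (hp _ _ _ x y)).sub (hp _ _ _ x y)
  · refine StandardModel.alt3_eq_zero_of_tangent hx (fun k a b c => ?_) (fun b c => ?_) (h x hx)
      a b c
    · simp only [alt3, cubU, sub_eq_add_neg a, ← neg_smul, map_add, map_smul,
        LinearMap.add_apply, LinearMap.smul_apply, smul_eq_mul]
      ring
    -- It is easier to insert x into W: all terms contain br(x,x,x) = 0 except two that cancel by
    -- pair symmetry.
    · have hW := hF.alt_cubW hS hbr x x b c
      have e : S (br b x x) x (br c x x) x = S (br c x x) x (br b x x) x := by
        rw [hS.pair]
      have h0 : alt3 (cubW S br x) x b c = 0 := by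
        simp only [alt3, cubW, hbr.diag, map_zero, LinearMap.zero_apply, e]
        ring
      linarith

end Extension

/-! ### The Nijenhuis torsion as an algebraic expression -/

section Torsion

variable {V : Type*} [AddCommGroup V] [Module ℝ V]

/-- The Nijenhuis torsion at `x` in terms of the algebraic curvature tensor. -/
def torsionForm (S : Tensor4 V) (br : V →ₗ[ℝ] V →ₗ[ℝ] V →ₗ[ℝ] V) (x a b c : V) : ℝ :=
  2 * S x (br a x x) b c - 2 * S x (br b x x) a c + 2 * S x b a (br c x x)
    - 2 * S x a b (br c x x)

variable {S : Tensor4 V} {br : V →ₗ[ℝ] V →ₗ[ℝ] V →ₗ[ℝ] V}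

theorem alt_torsionForm (hS : IsSymCurvatureTensor S) (x a b c : V) :
    alt3 (torsionForm S br x) a b c
      = 4 * alt3 (fun a b c => S (br c x x) a x b) a b c := by
  have e1 : ∀ a b c, S x (br a x x) c b = S x (br a x x) b c := fun a b c => hS.symm_right _ _ _ _
  have e2 : ∀ a b c, S x a b (br c x x) = S (br c x x) b x a := fun a b c => by
    rw [← hS.pair, hS.symm_left]
  have f1 := e1 a b c
  have f2 := e1 b a c
  have f3 := e1 c a b
  simp only [alt3, torsionForm, e2]
  linear_combination -4 * f1 + 4 * f2 - 4 * f3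

/-- In terms of U and W the alternation is -4 Alt W - 8 Alt U; the first condition gives Alt W = 2
Alt U. -/
theorem alt_torsionForm_apply (hS : IsSymCurvatureTensor S) (hbr : IsContraction S br)
    (hF : AlgFirst S br) (x a b c : V) :
    alt3 (fun a b c => torsionForm S br x a b (br c x x)) a b c
      = -16 * alt3 (cubU S br x) a b c := by
  have hW := hF.alt_cubW hS hbr x a b c
  have e : ∀ a b c, torsionForm S br x a b (br c x x)
      = 2 * cubW S br x a c b - 2 * cubW S br x b c a - 4 * cubU S br x a b c
        + 4 * cubU S br x b a c := fun a b c => by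
    have e1 : ∀ a b, S x (br a x x) b (br c x x) = cubW S br x a c b := fun a b => by
      rw [hS.symm_left, hS.symm_right]; rfl
    have e2 : ∀ a b, S x a b (br (br c x x) x x) = -2 * cubU S br x b a c := fun a b => by
      rw [← hS.pair, hS.symm_left, hbr.adj, hS.apply_mid]; rfl
    rw [torsionForm, e1, e1, e2, e2]
    ring
  simp only [e]
  generalize cubW S br x = W at *
  generalize cubU S br x = U at *
  simp only [alt3] at *
  linear_combination -4 * hW

end Torsion

/-! ### Derivatives along M and the integrability conditions -/

section Geometry

open Filter Topology

variable {V : Type*} [NormedAddCommGroup V] [NormedSpace ℝ V]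

theorem hasDerivAt_bilin [FiniteDimensional ℝ V] (B : V →ₗ[ℝ] V →ₗ[ℝ] ℝ) {p q : ℝ → V} {p' q' : V} {t : ℝ}
    (hp : HasDerivAt p p' t) (hq : HasDerivAt q q' t) :
    HasDerivAt (fun t => B (p t) (q t)) (B p' (q t) + B (p t) q') t := by
  have h := (B.toContinuousBilinearMap.hasFDerivAt.comp_hasDerivAt t hp).clm_apply hq
  exact h

set_option maxSynthPendingDepth 3 in
theorem hasDerivAt_tensor4 [FiniteDimensional ℝ V] (S : Tensor4 V) {p q r s : ℝ → V} {p' q' r' s' : V} {t : ℝ}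
    (hp : HasDerivAt p p' t) (hq : HasDerivAt q q' t) (hr : HasDerivAt r r' t)
    (hs : HasDerivAt s s' t) :
    HasDerivAt (fun t => S (p t) (q t) (r t) (s t))
      (S p' (q t) (r t) (s t) + S (p t) q' (r t) (s t) + S (p t) (q t) r' (s t)
        + S (p t) (q t) (r t) s') t := by
  let C2 : (V →ₗ[ℝ] V →ₗ[ℝ] ℝ) →ₗ[ℝ] V →L[ℝ] V →L[ℝ] ℝ :=
    { toFun := fun B => B.toContinuousBilinearMap
      map_add' := fun _ _ => by ext; rfl
      map_smul' := fun _ _ => by ext; rfl }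
  let S' : V →L[ℝ] V →L[ℝ] V →L[ℝ] V →L[ℝ] ℝ :=
    (S.compr₂ C2).toContinuousBilinearMap
  have h := (((S'.hasFDerivAt.comp_hasDerivAt t hp).clm_apply hq).clm_apply hr).clm_apply hs
  exact h

namespace StandardModel

variable {g : LinearMap.BilinForm ℝ V} {M : StandardModel V}

/-- The hyperplane contains the line x + tz. On the pseudo-sphere this line is normalised; since
g(x,z) = 0, the normalising factor has zero derivative at 0 and the velocity stays z. -/
theorem exists_curve (hsymm : g.IsSymm) {x z : V} (hx : x ∈ M.carrier g)
    (hz : M.IsTangent g x z) :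
    ∃ γ : ℝ → V, γ 0 = x ∧ HasDerivAt γ z 0 ∧ ∀ᶠ t in 𝓝 0, γ t ∈ M.carrier g := by
  have hline : HasDerivAt (fun t : ℝ => x + t • z) z 0 := by
    simpa using ((hasDerivAt_id (0 : ℝ)).smul_const z).const_add x
  cases M with
  | sphere =>
    have hx1 : g x x = 1 := hx
    have hz0 : g z x = 0 := hz
    have hz1 : g x z = 0 := (hsymm.eq z x).symm.trans hz0
    have e : ∀ t : ℝ, g (x + t • z) (x + t • z) = 1 + t ^ 2 * g z z := fun t => by
      simp only [map_add, map_smul, LinearMap.add_apply, LinearMap.smul_apply, smul_eq_mul,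
        hx1, hz0, hz1]
      ring
    have hd : HasDerivAt (fun t : ℝ => 1 + t ^ 2 * g z z) 0 0 := by
      simpa using (((hasDerivAt_id (0 : ℝ)).pow 2).mul_const (g z z)).const_add 1
    have hr : HasDerivAt (fun t : ℝ => (√(1 + t ^ 2 * g z z))⁻¹) 0 0 := by
      have h1 : HasDerivAt (fun t : ℝ => (√(1 + t ^ 2 * g z z))⁻¹) _ 0 :=
        (hd.sqrt (by simp)).inv (by simp)
      simpa using h1
    refine ⟨fun t => (√(1 + t ^ 2 * g z z))⁻¹ • (x + t • z), by simp, ?_, ?_⟩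
    · have h1 : HasDerivAt (fun t : ℝ => (√(1 + t ^ 2 * g z z))⁻¹ • (x + t • z)) _ 0 :=
        hr.smul hline
      convert h1 using 1
      simp
    · have hpos : ∀ᶠ t : ℝ in 𝓝 0, 0 < 1 + t ^ 2 * g z z :=
        hd.continuousAt.eventually (lt_mem_nhds (by simp))
      filter_upwards [hpos] with t ht
      simp only [carrier, Set.mem_ofPred_eq]
      rw [map_smul, map_smul, LinearMap.smul_apply, smul_eq_mul, smul_eq_mul, e, ← mul_assoc,
        ← mul_inv, Real.mul_self_sqrt ht.le, inv_mul_cancel₀ ht.ne']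
  | hyperplane u =>
    have hx1 : g x u = 1 := hx
    have hz0 : g z u = 0 := hz
    exact ⟨fun t => x + t • z, by simp, hline, Eventually.of_forall fun t => by
      simp [carrier, hx1, hz0]⟩

/-- A derivative within the hypersurface M is not unique as a linear map on V. Curves in M determine
its values on tangent vectors, the only ones needed. -/
theorem hasDerivAt_comp_curve {Y : V → V} (hY : ContDiffOn ℝ ∞ Y (M.carrier g)) {γ : ℝ → V}
    {x z : V} (hx : x ∈ M.carrier g) (h0 : γ 0 = x) (hγ : HasDerivAt γ z 0)
    (hM : ∀ᶠ t in 𝓝 0, γ t ∈ M.carrier g) :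
    HasDerivAt (fun t => Y (γ t)) (fderivWithin ℝ Y (M.carrier g) x z) 0 := by
  have hd : HasFDerivWithinAt Y (fderivWithin ℝ Y (M.carrier g) x) (M.carrier g) (γ 0) := by
    rw [h0]
    exact ((hY x hx).differentiableWithinAt (by norm_num)).hasFDerivWithinAt
  have h := hd.comp_hasDerivWithinAt (s := γ ⁻¹' M.carrier g) 0
    hγ.hasDerivWithinAt (Set.mapsTo_preimage _ _)
  exact h.hasDerivAt hM

/-- A vector field with prescribed tangent value. -/
def extend (g : LinearMap.BilinForm ℝ V) : StandardModel V → V → V → V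
  | sphere, w, y => w - g w y • y
  | hyperplane u, w, _ => w - (g w u / g u u) • u

theorem extend_apply {x w : V} (hw : M.IsTangent g x w) : M.extend g w x = w := by
  cases M with
  | sphere =>
    have : g w x = 0 := hw
    simp [extend, this]
  | hyperplane u =>
    have : g w u = 0 := hw
    simp [extend, this]

variable [FiniteDimensional ℝ V]

theorem extend_isVectorField (hM : M.IsAdmissible g) (w : V) :
    M.IsVectorField g (M.extend g w) := by
  cases M with
  | sphere =>
    refine ⟨?_, fun x hx => ?_⟩
    · have h1 : ContDiff ℝ ∞ fun y => g w y := (g w).toContinuousLinearMap.contDiff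
      exact (contDiff_const.sub (h1.smul contDiff_id)).contDiffOn
    · have hx1 : g x x = 1 := hx
      simp [IsTangent, extend, normal, hx1]
  | hyperplane u =>
    have hu : g u u ≠ 0 := hM
    refine ⟨contDiffOn_const, fun x hx => ?_⟩
    simp [IsTangent, extend, normal, hu]

/-- The derivative of the extension is a multiple of x, and a nonzero multiple occurs only when x is
the normal. Its pairing with tangent vectors therefore vanishes. -/
theorem hasDerivAt_extend {γ : ℝ → V} {x z w : V} (h0 : γ 0 = x) (hγ : HasDerivAt γ z 0)
    (hw : M.IsTangent g x w) : ∃ k : ℝ, HasDerivAt (fun t => M.extend g w (γ t)) (k • x) 0 ∧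
      (k = 0 ∨ M.normal x = x) := by
  cases M with
  | sphere =>
    have hw0 : g w x = 0 := hw
    refine ⟨-g w z, ?_, Or.inr rfl⟩
    have h1 : HasDerivAt (fun t => g w (γ t)) (g w z) 0 :=
      (g w).toContinuousLinearMap.hasFDerivAt.comp_hasDerivAt 0 hγ
    have h2 := (h1.smul hγ).const_sub w
    simpa [h0, hw0, extend] using h2
  | hyperplane u =>
    exact ⟨0, by simpa [extend] using hasDerivAt_const (0 : ℝ) _, Or.inl rfl⟩

variable {K : V → V →ₗ[ℝ] V} {S : Tensor4 V}

theorem IsKillingTensor.isTangent (hK : M.IsKillingTensor g K) (hM : M.IsAdmissible g) {x w : V}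
    (hx : x ∈ M.carrier g) (hw : M.IsTangent g x w) : M.IsTangent g x (K x w) := by
  have := (hK.smooth _ (extend_isVectorField hM w)).tangent x hx
  rwa [extend_apply hw] at this

/-- Both sides of g(K Y, W) = S(x,x,Y,W) are differentiated along a curve in M, with W extending w.
The derivative of W is a multiple of x and contributes to neither side. -/
theorem deriv_apply (hsymm : g.IsSymm) (hM : M.IsAdmissible g) (hK : M.IsKillingTensor g K)
    (hS : IsSymCurvatureTensor S) (hKS : RepresentsS g M K S) {Y : V → V}
    (hY : M.IsVectorField g Y) {x z w : V} (hx : x ∈ M.carrier g) (hz : M.IsTangent g x z)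
    (hw : M.IsTangent g x w) :
    g (fderivWithin ℝ (fun y => K y (Y y)) (M.carrier g) x z) w
      = 2 * S x z (Y x) w + S x x (fderivWithin ℝ Y (M.carrier g) x z) w := by
  obtain ⟨γ, h0, hγ, hγM⟩ := exists_curve hsymm hx hz
  have hKY := hasDerivAt_comp_curve (hK.smooth Y hY).smooth hx h0 hγ hγM
  have hYd := hasDerivAt_comp_curve hY.smooth hx h0 hγ hγM
  obtain ⟨k, hW, hk⟩ := hasDerivAt_extend h0 hγ hw
  have h1 := hasDerivAt_bilin g hKY hW
  have h2 := hasDerivAt_tensor4 S hγ hγ hYd hW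
  have heq : (fun t => g (K (γ t) (Y (γ t))) (M.extend g w (γ t)))
      =ᶠ[𝓝 0] fun t => S (γ t) (γ t) (Y (γ t)) (M.extend g w (γ t)) := by
    filter_upwards [hγM] with t ht
    exact hKS _ ht _ _ (hY.tangent _ ht) ((extend_isVectorField hM w).tangent _ ht)
  have h3 := h1.unique (h2.congr_of_eventuallyEq heq)
  have hKt : k * g (K x (Y x)) x = 0 := by
    rcases hk with hk | hk
    · rw [hk, zero_mul]
    · have := (hK.smooth Y hY).tangent x hx
      rw [IsTangent, hk] at this
      rw [this, mul_zero]
  simp only [h0, extend_apply hw, map_smul, smul_eq_mul, hKt, hS.symm_right x x x (Y x),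
    hS.apply_self, mul_zero, add_zero, hS.symm_left x z] at h3
  rw [h3]; ring

theorem apply_deriv_normal (hsymm : g.IsSymm) {Y : V → V}
    (hY : M.IsVectorField g Y) {x z : V} (hx : x ∈ M.carrier g) (hz : M.IsTangent g x z) :
    g (fderivWithin ℝ Y (M.carrier g) x z) (M.normal x)
      = match M with | sphere => -g (Y x) z | hyperplane _ => 0 := by
  obtain ⟨γ, h0, hγ, hγM⟩ := exists_curve hsymm hx hz
  have hYd := hasDerivAt_comp_curve hY.smooth hx h0 hγ hγM
  have hzero : HasDerivAt (fun t => g (Y (γ t)) (M.normal (γ t))) 0 0 :=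
    (hasDerivAt_const (0 : ℝ) (0 : ℝ)).congr_of_eventuallyEq <| by
      filter_upwards [hγM] with t ht
      exact hY.tangent _ ht
  cases M with
  | sphere =>
    have h := (hasDerivAt_bilin g hYd hγ).unique hzero
    rw [h0] at h
    exact eq_neg_of_add_eq_zero_left h
  | hyperplane u =>
    have h := (hasDerivAt_bilin g hYd (hasDerivAt_const (0 : ℝ) u)).unique hzero
    rwa [map_zero, add_zero] at h

/-- The derivative of Y need not be tangent. On the pseudo-sphere its x-component is killed by both
sides; on the hyperplane it is tangent. -/
theorem tensor_deriv (hsymm : g.IsSymm) (hM : M.IsAdmissible g) (hK : M.IsKillingTensor g K)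
    (hS : IsSymCurvatureTensor S) (hKS : RepresentsS g M K S) {Y : V → V}
    (hY : M.IsVectorField g Y) {x z w : V} (hx : x ∈ M.carrier g) (hz : M.IsTangent g x z)
    (hw : M.IsTangent g x w) :
    S x x (fderivWithin ℝ Y (M.carrier g) x z) w
      = g (fderivWithin ℝ Y (M.carrier g) x z) (K x w) := by
  have tang : ∀ v, M.IsTangent g x v → S x x v w = g v (K x w) := fun v hv => by
    rw [← hKS x hx v w hv hw, hK.symm x hx v w hv hw]
    exact hsymm.eq _ _
  cases M with
  | sphere =>
    have all : ∀ v, S x x v w = g v (K x w) := fun v => by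
      have h1 := tang _ (isTangent_sub hx v)
      have h2 : g x (K x w) = 0 := (hsymm.eq _ _).symm.trans (hK.isTangent hM hx hw)
      simp only [sub_eq_add_neg, ← neg_smul, map_add, map_smul, LinearMap.add_apply,
        LinearMap.smul_apply, hS.apply_self, h2, smul_eq_mul, mul_zero, add_zero] at h1
      exact h1
    exact all _
  | hyperplane u =>
    exact tang _ (apply_deriv_normal hsymm hY hx hz)

theorem bracket_isTangent (hsymm : g.IsSymm) {X Y : V → V}
    (hX : M.IsVectorField g X) (hY : M.IsVectorField g Y) {x : V} (hx : x ∈ M.carrier g) :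
    M.IsTangent g x (VectorField.lieBracketWithin ℝ X Y (M.carrier g) x) := by
  have h1 := apply_deriv_normal hsymm hY hx (hX.tangent x hx)
  have h2 := apply_deriv_normal hsymm hX hx (hY.tangent x hx)
  rw [IsTangent, VectorField.lieBracketWithin, map_sub, LinearMap.sub_apply, h1, h2]
  cases M with
  | sphere =>
    have : g (X x) (Y x) = g (Y x) (X x) := hsymm.eq _ _
    simp [this]
  | hyperplane u => simp

/-- The Nijenhuis torsion of a Killing tensor in terms of its algebraic curvature tensor. -/
theorem nijenhuis_apply (hsymm : g.IsSymm) (hM : M.IsAdmissible g) (hK : M.IsKillingTensor g K)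
    (hS : IsSymCurvatureTensor S) (hKS : RepresentsS g M K S) {X Y : V → V}
    (hX : M.IsVectorField g X) (hY : M.IsVectorField g Y) {x w : V} (hx : x ∈ M.carrier g)
    (hw : M.IsTangent g x w) :
    g (M.nijenhuis g K X Y x) w = 2 * S x (K x (X x)) (Y x) w - 2 * S x (K x (Y x)) (X x) w
      + 2 * S x (Y x) (X x) (K x w) - 2 * S x (X x) (Y x) (K x w) := by
  have hKw := hK.isTangent hM hx hw
  have hKX := hK.smooth X hX
  have hKY := hK.smooth Y hY
  have tX := hX.tangent x hx
  have tY := hY.tangent x hx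
  have tKX := hKX.tangent x hx
  have tKY := hKY.tangent x hx
  have hKB : ∀ {Z W : V → V}, M.IsVectorField g Z → M.IsVectorField g W →
      g (K x (VectorField.lieBracketWithin ℝ Z W (M.carrier g) x)) w
        = S x x (fderivWithin ℝ W (M.carrier g) x (Z x)) w
          - S x x (fderivWithin ℝ Z (M.carrier g) x (W x)) w := fun {Z W} hZ hW => by
    have hB := bracket_isTangent hsymm hZ hW hx
    rw [hK.symm x hx _ _ hB hw, show g (K x w) _ = g _ (K x w) from hsymm.eq _ _,
      tensor_deriv hsymm hM hK hS hKS hW hx (hZ.tangent x hx) hw,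
      tensor_deriv hsymm hM hK hS hKS hZ hx (hW.tangent x hx) hw,
      VectorField.lieBracketWithin, map_sub, LinearMap.sub_apply]
  have hKKB : g (K x (K x (VectorField.lieBracketWithin ℝ X Y (M.carrier g) x))) w
      = S x x (fderivWithin ℝ Y (M.carrier g) x (X x)) (K x w)
        - S x x (fderivWithin ℝ X (M.carrier g) x (Y x)) (K x w) := by
    have hB := bracket_isTangent hsymm hX hY hx
    rw [hK.symm x hx _ _ (hK.isTangent hM hx hB) hw,
      show g (K x w) _ = g _ (K x w) from hsymm.eq _ _,
      hK.symm x hx _ _ hB hKw, show g (K x (K x w)) _ = g _ (K x (K x w)) from hsymm.eq _ _,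
      tensor_deriv hsymm hM hK hS hKS hY hx tX hKw,
      tensor_deriv hsymm hM hK hS hKS hX hx tY hKw,
      VectorField.lieBracketWithin, map_sub, LinearMap.sub_apply]
  -- Once the brackets are expanded, all terms with derivatives of X and Y cancel, leaving those in
  -- which the base point of S is differentiated.
  rw [nijenhuis, map_add, map_sub, map_sub, LinearMap.add_apply, LinearMap.sub_apply,
    LinearMap.sub_apply, hKKB, hKB hKX hY, hKB hX hKY,
    tensor_deriv hsymm hM hK hS hKS hKX hx tY hw, tensor_deriv hsymm hM hK hS hKS hKY hx tX hw,
    deriv_apply hsymm hM hK hS hKS hX hx tY hKw, deriv_apply hsymm hM hK hS hKS hY hx tX hKw,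
    VectorField.lieBracketWithin, map_sub, LinearMap.sub_apply,
    deriv_apply hsymm hM hK hS hKS hX hx tKY hw, deriv_apply hsymm hM hK hS hKS hY hx tKX hw]
  ring

/-- Both vectors are tangent and have equal products with tangent vectors. As the normal is not
null, their difference is orthogonal to all of V and so zero. -/
theorem contraction_eq {ι : Type*} [Fintype ι] [DecidableEq ι] (e : Module.Basis ι ℝ V)
    (hsymm : g.IsSymm) (hnondeg : g.Nondegenerate) (hM : M.IsAdmissible g)
    (hK : M.IsKillingTensor g K) (hS : IsSymCurvatureTensor S) (hKS : RepresentsS g M K S)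
    {x c : V} (hx : x ∈ M.carrier g) (hc : M.IsTangent g x c) :
    contraction g M e S c x x = K x c := by
  have hproj : ∀ w, M.IsTangent g x w → M.proj g w = w := fun w hw => by
    cases M with
    | sphere => rfl
    | hyperplane u =>
      have : g w u = 0 := hw
      simp [proj, this]
  have hbt : M.IsTangent g x (contraction g M e S c x x) := by
    cases M with
    | sphere =>
      rw [IsTangent, apply_contraction hsymm hnondeg]
      change S x c x x = 0
      rw [hS.pair, hS.apply_self]
    | hyperplane u =>
      have hu : g u u ≠ 0 := hM
      have h0 : proj g (hyperplane u) u = 0 := by simp [proj, hu]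
      change g _ u = 0
      rw [apply_contraction hsymm hnondeg, h0]
      simp
  have hKt := hK.isTangent hM hx hc
  rw [← sub_eq_zero]
  refine hnondeg.1 _ fun v => ?_
  have h1 : ∀ w, M.IsTangent g x w → g (contraction g M e S c x x - K x c) w = 0 := fun w hw => by
    rw [map_sub, LinearMap.sub_apply, apply_contraction hsymm hnondeg, hproj w hw, hS.pair,
      hS.symm_right, hKS x hx _ _ hc hw, hS.symm_right, sub_self]
  have hn : g (M.normal x) (M.normal x) ≠ 0 := by
    cases M with
    | sphere => exact ne_of_eq_of_ne (show g x x = 1 from hx) one_ne_zero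
    | hyperplane u => exact hM
  have h2 : g (contraction g M e S c x x - K x c) (M.normal x) = 0 := by
    rw [map_sub, LinearMap.sub_apply, hbt, hKt, sub_self]
  have h3 : M.IsTangent g x (M.tangentProj g x v) := by
    rw [IsTangent, tangentProj, map_sub, LinearMap.sub_apply, map_smul, LinearMap.smul_apply,
      smul_eq_mul, div_mul_cancel₀ _ hn, sub_self]
  have h4 := h1 _ h3
  rw [tangentProj, map_sub, map_smul, h2, smul_zero, sub_zero] at h4
  exact h4

/-- The first integrability condition in algebraic form. -/
theorem algFirst {ι : Type*} [Fintype ι] [DecidableEq ι] (e : Module.Basis ι ℝ V)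
    (hsymm : g.IsSymm) (hnondeg : g.Nondegenerate) (hM : M.IsAdmissible g)
    (hK : M.IsKillingTensor g K) (hS : IsSymCurvatureTensor S) (hKS : RepresentsS g M K S)
    (hfirst : M.FirstIntegrability g K) : AlgFirst S (contraction g M e S) := by
  refine algFirst_of_tangent hsymm hM hS (contraction_isContraction hsymm hnondeg hM e hS)
    fun x hx a b c ha hb hc => ?_
  have hv : ∀ i, M.IsTangent g x (![a, b, c] i) := by
    intro i; fin_cases i
    exacts [ha, hb, hc]
  have h := hfirst (fun i => M.extend g (![a, b, c] i)) (fun i => extend_isVectorField hM _) x hx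
  have hN : ∀ i j k, g (M.nijenhuis g K (M.extend g (![a, b, c] i)) (M.extend g (![a, b, c] j)) x)
      (M.extend g (![a, b, c] k) x)
      = torsionForm S (contraction g M e S) x (![a, b, c] i) (![a, b, c] j) (![a, b, c] k) :=
    fun i j k => by
      rw [extend_apply (hv k), nijenhuis_apply hsymm hM hK hS hKS (extend_isVectorField hM _)
        (extend_isVectorField hM _) hx (hv k)]
      simp only [extend_apply (hv _), contraction_eq e hsymm hnondeg hM hK hS hKS hx (hv _),
        torsionForm]
  simp only [hN] at h
  rw [sum_perm_fin_three, alt_torsionForm hS] at h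
  exact (mul_eq_zero.mp h).resolve_left (by norm_num)

/-- The second integrability condition in algebraic form. -/
theorem secondIntegrability_iff {ι : Type*} [Fintype ι] [DecidableEq ι] (e : Module.Basis ι ℝ V)
    (hsymm : g.IsSymm) (hnondeg : g.Nondegenerate) (hM : M.IsAdmissible g)
    (hK : M.IsKillingTensor g K) (hS : IsSymCurvatureTensor S) (hKS : RepresentsS g M K S)
    (hF : AlgFirst S (contraction g M e S)) :
    M.SecondIntegrability g K ↔ ∀ x a b c, alt3 (cubU S (contraction g M e S) x) a b c = 0 := by
  have hbr := contraction_isContraction hsymm hnondeg hM e hS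
  have key : ∀ X : Fin 3 → V → V, (∀ i, M.IsVectorField g (X i)) → ∀ x ∈ M.carrier g,
      ∑ σ : Equiv.Perm (Fin 3), ((Equiv.Perm.sign σ : ℤ) : ℝ) *
        g (K x (X (σ 2) x)) (M.nijenhuis g K (X (σ 0)) (X (σ 1)) x)
      = -16 * alt3 (cubU S (contraction g M e S) x) (X 0 x) (X 1 x) (X 2 x) := by
    intro X hX x hx
    have hv := fun i => (hX i).tangent x hx
    have hN : ∀ i j k, g (K x (X k x)) (M.nijenhuis g K (X i) (X j) x)
        = torsionForm S (contraction g M e S) x (X i x) (X j x)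
          (contraction g M e S (X k x) x x) := fun i j k => by
      have hKv := hK.isTangent hM hx (hv k)
      rw [show g (K x (X k x)) _ = g _ (K x (X k x)) from hsymm.eq _ _,
        nijenhuis_apply hsymm hM hK hS hKS (hX i) (hX j) hx hKv]
      simp only [torsionForm, contraction_eq e hsymm hnondeg hM hK hS hKS hx (hv _),
        contraction_eq e hsymm hnondeg hM hK hS hKS hx hKv]
    simp only [hN]
    rw [← alt_torsionForm_apply hS hbr hF]
    exact sum_perm_fin_three (fun a b c => torsionForm S (contraction g M e S) x a b
      (contraction g M e S c x x)) (fun i => X i x)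
  constructor
  · intro h
    refine alt_cubU_of_tangent hsymm hM hS hbr hF fun x hx a b c ha hb hc => ?_
    have h1 := h (fun i => M.extend g (![a, b, c] i)) (fun i => extend_isVectorField hM _) x hx
    rw [key _ (fun i => extend_isVectorField hM _) x hx] at h1
    have h2 := (mul_eq_zero.mp h1).resolve_left (by norm_num)
    simpa only [Matrix.cons_val_zero, Matrix.cons_val_one, Matrix.cons_val, extend_apply ha,
      extend_apply hb, extend_apply hc] using h2
  · intro h X hX x hx
    rw [key X hX x hx, h, mul_zero]

end StandardModel

end Geometry
end KillingCSC

end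

/-! ### Assembly in components -/

theorem mainTheorem4
    {V : Type*} [NormedAddCommGroup V] [NormedSpace ℝ V] [FiniteDimensional ℝ V]
    {ι : Type*} [Fintype ι] [DecidableEq ι] (e : Module.Basis ι ℝ V)
    (g : LinearMap.BilinForm ℝ V) (hsymm : g.IsSymm) (hnondeg : g.Nondegenerate)
    (M : KillingCSC.StandardModel V) (hM : M.IsAdmissible g)
    (K : V → V →ₗ[ℝ] V) (hK : M.IsKillingTensor g K)
    (S : KillingCSC.Tensor4 V) (hS : KillingCSC.IsSymCurvatureTensor S)
    (hKS : KillingCSC.RepresentsS g M K S)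
    (R : KillingCSC.Tensor4 V) (hR : KillingCSC.IsCurvatureTensor R)
    (hKR : KillingCSC.RepresentsR g M K R)
    (hfirst : M.FirstIntegrability g K) :
    List.TFAE [
      -- the second integrability condition
      M.SecondIntegrability g K,
      -- the two hook conditions
      KillingCSC.hookAdjoint (fun m => KillingCSC.cubic g M e S
        (m .c2) (m .d1) (m .d2) (m .b1) (m .b2) (m .f2) (m .e1) (m .e2)) = 0,
      KillingCSC.hookAdjoint (fun m => KillingCSC.cubic g M e S
        (m .c2) (m .b1) (m .b2) (m .d1) (m .d2) (m .f2) (m .e1) (m .e2)) = 0,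
      -- antisymmetrisation in three and symmetrisation in five indices
      KillingCSC.alt3sym5 (fun m => KillingCSC.cubic g M e S
        (m .c2) (m .d1) (m .d2) (m .b1) (m .b2) (m .f2) (m .e1) (m .e2)) = 0,
      KillingCSC.alt3sym5 (fun m => KillingCSC.cubic g M e S
        (m .c2) (m .b1) (m .b2) (m .d1) (m .d2) (m .f2) (m .e1) (m .e2)) = 0,
      -- antisymmetrisation in four and symmetrisation in four indices
      KillingCSC.alt4sym4 (fun m => KillingCSC.cubic g M e S
        (m .c2) (m .d1) (m .d2) (m .b1) (m .b2) (m .f2) (m .e1) (m .e2)) = 0,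
      KillingCSC.alt4sym4 (fun m => KillingCSC.cubic g M e S
        (m .c2) (m .d1) (m .d2) (m .b2) (m .b1) (m .f2) (m .e1) (m .e2)) = 0,
      KillingCSC.alt4sym4 (fun m => KillingCSC.cubic g M e S
        (m .c2) (m .d1) (m .d2) (m .e1) (m .e2) (m .f2) (m .b1) (m .b2)) = 0,
      -- the condition on the algebraic curvature tensor
      KillingCSC.alt4sym4 (fun m => KillingCSC.cubic g M e R
        (m .d1) (m .c2) (m .d2) (m .e1) (m .e2) (m .b1) (m .f2) (m .b2)) = 0] := by
  have hF := KillingCSC.StandardModel.algFirst e hsymm hnondeg hM hK hS hKS hfirst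
  have hbr := KillingCSC.contraction_isContraction hsymm hnondeg hM e hS
  have hRS := KillingCSC.quadratic_eq hsymm hM hS hKS hR hKR
  have hbrR : ∀ x c d, KillingCSC.contraction g M e R x c d = (2 / 3 : ℝ) •
      (KillingCSC.contraction g M e S c x d - KillingCSC.contraction g M e S d x c) :=
    fun x c d => by
      simp only [KillingCSC.contraction_apply, ← map_sub, ← map_smul]
      congr 2
      ext y
      exact KillingCSC.curvature_of_quadratic hR hS hRS y x c d
  have h := KillingCSC.tfae_cubic hS hbr hF hR hRS hbrR
  rw [← KillingCSC.StandardModel.secondIntegrability_iff e hsymm hnondeg hM hK hS hKS hF] at h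
  simp only [KillingCSC.cubic_eq hsymm hnondeg]
  -- The symmetrisers preserve multilinearity, so vanishing on basis vectors is the same as
  -- vanishing on all vectors.
  have hook : ∀ {T : KillingCSC.Tensor8 V}, KillingCSC.IsMultilinear8 T →
      (KillingCSC.hookAdjoint (fun m : KillingCSC.Label → ι => T (e ∘ m)) = 0 ↔
        KillingCSC.hookAdjoint T = 0) := fun hT =>
    ((hT.rowSym _).colAlt _).comp_basis_eq_zero_iff e
  have sym5 : ∀ {T : KillingCSC.Tensor8 V}, KillingCSC.IsMultilinear8 T →
      (KillingCSC.alt3sym5 (fun m : KillingCSC.Label → ι => T (e ∘ m)) = 0 ↔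
        KillingCSC.alt3sym5 T = 0) := fun hT =>
    ((hT.rowSym _).colAlt _).comp_basis_eq_zero_iff e
  have sym4 : ∀ {T : KillingCSC.Tensor8 V}, KillingCSC.IsMultilinear8 T →
      (KillingCSC.alt4sym4 (fun m : KillingCSC.Label → ι => T (e ∘ m)) = 0 ↔
        KillingCSC.alt4sym4 T = 0) := fun hT =>
    ((hT.rowSym _).colAlt _).comp_basis_eq_zero_iff e
  rw [← hook (KillingCSC.cubicTensor_isMultilinear S _ (by decide)),
    ← hook (KillingCSC.cubicTensor_isMultilinear S _ (by decide)),
    ← sym5 (KillingCSC.cubicTensor_isMultilinear S _ (by decide)),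
    ← sym5 (KillingCSC.cubicTensor_isMultilinear S _ (by decide)),
    ← sym4 (KillingCSC.cubicTensor_isMultilinear S _ (by decide)),
    ← sym4 (KillingCSC.cubicTensor_isMultilinear S _ (by decide)),
    ← sym4 (KillingCSC.cubicTensor_isMultilinear S _ (by decide)),
    ← sym4 (KillingCSC.cubicTensor_isMultilinear R _ (by decide))] at h
  exact h
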